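/- Let $d\in\{2,3\}$, let $\Omega\subset\mathbb R^d$ be a non-empty open set with $\operatorname{int}\overline\Omega=\Omega$ (for example a polygonal or Lipschitz polyhedral domain), let $\Gamma_D\subset\partial\Omega$, let $\partial\Omega\setminus\Gamma_D$ have positive surface measure, and let $r\ge 2$. Consider problems consisting of the following data, where all constants $k_0,c_\eta,\kappa,c_\delta>0$, $C_\eta,C_{\rm int},C_\chi,C_h$ and $0<b<1$ are the same for all problems considered. *Parameters.* $k\ge k_0$, $\varepsilon\in\mathbb R$ with $|\varepsilon|\le k^2$, $\eta\in\mathbb C$ with $c_\eta k\le|\eta|\le C_\eta k$. *Finite elements.* A finite conforming simplicial mesh of $\overline\Omega$ with elements $\tau$ of diameter $h_\tau$ that each contain a ball of radius $h_\tau/\kappa$, with $h=\max_\tau h_\tau$, and such that $\Gamma_D$ is a union of $(d-1)$-dimensional faces of the mesh. $\mathcal V^h$ is the space of continuous functions on $\overline\Omega$ that are polynomials of total degree at most $r-1$ on each element and vanish on $\Gamma_D$. It has a nodal basis $\phi_1,\dots,\phi_n$ with nodes $x_1,\dots,x_n\in\overline\Omega$, $\phi_p(x_q)=\delta_{pq}$,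 and the nodal interpolant $\Pi^hv=\sum_pv(x_p)\phi_p$ satisfies the standard estimate $$\|v-\Pi^hv\|_{L^2(\tau)}+h_\tau|v-\Pi^hv|_{H^1(\tau)}\le C_{\rm int}h_\tau^r|v|_{H^r(\tau)}$$ for every element $\tau$ and every continuous $v$ on $\overline\Omega$ that vanishes on $\Gamma_D$ and is smooth on $\tau$. *Decomposition.* Non-empty open sets $\Omega_1,\dots,\Omega_N$ with union $\Omega$, $\operatorname{int}\overline{\Omega_\ell}=\Omega_\ell$, each $\overline{\Omega_\ell}$ a union of elements and $\partial\Omega_\ell\setminus\Gamma_D\ne\emptyset$. There are $\delta_\ell>0$ such that, with $\Omega_{\ell,\mu}$ the set of points of $\Omega_\ell$ at distance at most $\mu$ from $\partial\Omega_\ell\setminus\partial\Omega$, we have $\Omega_{\ell,b\delta_\ell}\subset\Omega_\ell\cap\bigcup_{\ell'\ne\ell}\Omega_{\ell'}\subset\Omega_{\ell,\delta_\ell}$. There are continuous functions $\chi_\ell:\overline\Omega\to[0,1]$, affine on each element, zero outside $\overline{\Omega_\ell}$, with $\sum_\ell\chi_\ell=1$ and $|\nabla\chi_\ell|\le C_\chi/\delta_\ell$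 in the interior of each element. Put $\delta=\min_\ell\delta_\ell$ and $\Lambda=\max_\ell\#\{\ell':\overline{\Omega_\ell}\cap\overline{\Omega_{\ell'}}\ne\emptyset\}$. Assume $$kh\le C_h,\qquad k\delta\ge c_\delta .$$ *Matrices.* $(A_\varepsilon)_{pq}=\int_\Omega\nabla\phi_p\cdot\nabla\phi_q-(k^2+i\varepsilon)\int_\Omega\phi_p\phi_q-i\eta\int_{\partial\Omega\setminus\Gamma_D}\phi_p\phi_q$; $A_{\varepsilon,\ell}$ is defined by the same formula with $\Omega_\ell$ in place of $\Omega$, for the nodes $p,q$ on $\overline{\Omega_\ell}$; $(R_\ell\mathbf V)_p=\chi_\ell(x_p)V_p$ for the nodes $p$ on $\overline{\Omega_\ell}$; and $B_\varepsilon^{-1}=\sum_\ell R_\ell^\top A_{\varepsilon,\ell}^{-1}R_\ell$. Further $(D_k)_{pq}=\int_\Omega\nabla\phi_p\cdot\nabla\phi_q+k^2\int_\Omega\phi_p\phi_q$, and $D_{k,\ell}$ is defined likewise with $\Omega_\ell$ in place of $\Omega$, for the nodes on $\overline{\Omega_\ell}$; $\langle\mathbf V,\mathbf W\rangle_D=\mathbf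 W^*D\mathbf V$ and $\|\mathbf V\|_D=\langle\mathbf V,\mathbf V\rangle_D^{1/2}$. Then there is a constant $C>0$, depending only on $d,\Omega,\Gamma_D,r$ and the constants listed above (and so not on $k,\varepsilon,\eta$, the mesh, the nodal basis, the decomposition, $N$, $\delta$, $\Lambda$ or $\sigma$), such that the following holds. Consider any family of such problems, each with a number $\sigma>0$ such that $$\|(A_{\varepsilon,\ell}^{-1}R_\ell A_\varepsilon-R_\ell)\mathbf V\|_{D_{k,\ell}}\le\sigma\,\|\mathbf V|_{\overline{\Omega_\ell}}\|_{D_{k,\ell}}\qquad\text{for all }\mathbf V\in\mathbb C^n,\ \ell=1,\dots,N,$$ where $\mathbf V|_{\overline{\Omega_\ell}}$ is the restriction of $\mathbf V$ to the nodes on $\overline{\Omega_\ell}$. (i) For every problem of the family, $\|B_\varepsilon^{-1}A_\varepsilon\mathbf V\|_{D_k}\le C\Lambda(1+\sigma)\|\mathbf V\|_{D_k}$ for all $\mathbf V\in\mathbb C^n$; that is, $\|B_\varepsilon^{-1}A_\varepsilon\|_{D_k}\le C\Lambda(1+\sigma)$. (ii) If $k\delta\to\infty$ as $k\to\infty$ in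 the family, then for all problems of the family with $k$ sufficiently large there is $R\in\mathbb R$ with $|R|\le C\,\frac{\Lambda}{k\delta}(1+\sigma)$ and $$\min_{0\ne\mathbf V\in\mathbb C^n}\frac{|\langle\mathbf V,B_\varepsilon^{-1}A_\varepsilon\mathbf V\rangle_{D_k}|}{\|\mathbf V\|_{D_k}^2}\ \ge\ \Big(\frac1\Lambda-\sqrt2\,\sigma\Lambda\Big)+R .$$ -/

import Mathlib

open Filter Topology MeasureTheory
open scoped ContDiff

noncomputable section

namespace Schwarz

/-- Euclidean space of dimension `d`. -/
abbrev E (d : ℕ) := EuclideanSpace ℝ (Fin d)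

/-- On the set `τ`, the function `v` is a polynomial of total degree at most `m`. -/
def IsPolyOn {d : ℕ} (m : ℕ) (v : E d → ℝ) (τ : Set (E d)) : Prop :=
  ∃ p : MvPolynomial (Fin d) ℝ, p.totalDegree ≤ m ∧
    ∀ x ∈ τ, v x = MvPolynomial.eval (fun i => x i) p

/-- The `(d-1)`-dimensional surface measure (normalised to agree with Lebesgue measure on
hyperplanes). -/
def surface (d : ℕ) : Measure (E d) := Measure.euclideanHausdorffMeasure (d - 1)

/-- The `L²`-norm of `|f|` over `τ`. -/
def l2Norm {d : ℕ} {F : Type*} [NormedAddCommGroup F] (τ : Set (E d)) (f : E d → F) : ℝ :=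
  √(∫ x in τ, ‖f x‖ ^ 2)

/-- The data of one discretised Helmholtz problem together with one overlapping decomposition.
Functions are total functions on `ℝᵈ`, but only their values on the closed domain are used. -/
structure Discretisation (d : ℕ) where
  /-- wavenumber -/
  k : ℝ
  /-- absorption -/
  ε : ℝ
  /-- impedance parameter -/
  η : ℂ
  /-- the conforming simplicial mesh, with all faces of its elements -/
  mesh : Geometry.SimplicialComplex ℝ (E d)
  /-- number of nodes -/
  n : ℕ
  /-- the nodes -/
  node : Fin n → E d
  /-- the nodal basis functions -/
  φ : Fin n → E d → ℝ
  /-- number of subdomains -/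
  N : ℕ
  /-- the subdomains -/
  sub : Fin N → Set (E d)
  /-- the overlap parameters of the subdomains -/
  δℓ : Fin N → ℝ
  /-- the partition of unity -/
  χ : Fin N → E d → ℝ

namespace Discretisation

variable {d : ℕ} (P : Discretisation d)

/-- Vertex sets of the elements (the `d`-simplices) of the mesh. -/
def elements : Set (Finset (E d)) := {s | s ∈ P.mesh.faces ∧ s.card = d + 1}

/-- The closed simplex with vertex set `s`. -/
def cell (s : Finset (E d)) : Set (E d) := convexHull ℝ (s : Set (E d))

/-- The mesh diameter. -/
def h : ℝ := sSup ((fun s => Metric.diam (cell s)) '' P.elements)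

/-- The smallest overlap parameter. -/
def δ : ℝ := ⨅ ℓ, P.δℓ ℓ

open Classical in
/-- The largest number of subdomains whose closures meet the closure of a given one. -/
def Λ : ℕ := Finset.univ.sup fun ℓ : Fin P.N =>
  (Finset.univ.filter fun ℓ' : Fin P.N =>
    (closure (P.sub ℓ) ∩ closure (P.sub ℓ')).Nonempty).card

/-- Membership in the finite-element space: continuous functions on the closed domain that are
polynomials of total degree at most `r - 1` on every element and vanish on the Dirichlet
boundary. -/
def IsFE (Ω ΓD : Set (E d)) (r : ℕ) (v : E d → ℝ) : Prop :=
  ContinuousOn v (closure Ω) ∧ (∀ s ∈ P.elements, IsPolyOn (r - 1) v (cell s)) ∧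
    ∀ x ∈ ΓD, v x = 0

/-- The nodal interpolation operator. -/
def interp (v : E d → ℝ) : E d → ℝ := fun x => ∑ p, v (P.node p) * P.φ p x

/-- The part of a subdomain that is not overlapped by any other subdomain. -/
def core (ℓ : Fin P.N) : Set (E d) := P.sub ℓ \ ⋃ ℓ' ≠ ℓ, P.sub ℓ'

/-- The points of a subdomain whose distance from its interior boundary is at most `μ`. -/
def nearBoundary (Ω : Set (E d)) (ℓ : Fin P.N) (μ : ℝ) : Set (E d) :=
  {x ∈ P.sub ℓ | Metric.infEDist x (frontier (P.sub ℓ) \ frontier Ω) ≤ ENNReal.ofReal μ}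

/-! ### Matrices -/

/-- Stiffness matrix over the open set `U`. -/
def stiffness (U : Set (E d)) : Matrix (Fin P.n) (Fin P.n) ℝ := fun p q =>
  ∫ x in U, inner ℝ (gradient (P.φ p) x) (gradient (P.φ q) x)

/-- Domain mass matrix over the open set `U`. -/
def mass (U : Set (E d)) : Matrix (Fin P.n) (Fin P.n) ℝ := fun p q =>
  ∫ x in U, P.φ p x * P.φ q x

/-- Boundary mass matrix over the non-Dirichlet part of the boundary of `U`. -/
def boundaryMass (ΓD U : Set (E d)) : Matrix (Fin P.n) (Fin P.n) ℝ := fun p q =>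
  ∫ x in frontier U \ ΓD, P.φ p x * P.φ q x ∂(surface d)

/-- Matrix of the Helmholtz impedance form on `U` in all basis functions,
`S - (k² + iε) M - iη N`. -/
def helmholtz (ΓD U : Set (E d)) : Matrix (Fin P.n) (Fin P.n) ℂ :=
  (P.stiffness U).map (fun t => (t : ℂ))
    - ((P.k : ℂ) ^ 2 + Complex.I * (P.ε : ℂ)) • (P.mass U).map (fun t => (t : ℂ))
    - (Complex.I * P.η) • (P.boundaryMass ΓD U).map (fun t => (t : ℂ))

/-- Matrix of the Helmholtz energy inner product on `U` in all basis functions, `S + k² M`. -/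
def energy (U : Set (E d)) : Matrix (Fin P.n) (Fin P.n) ℂ :=
  (P.stiffness U).map (fun t => (t : ℂ)) + ((P.k : ℂ) ^ 2) • (P.mass U).map (fun t => (t : ℂ))

/-- Indices of the nodes on the closure of the subdomain `ℓ`. -/
abbrev LocalNode (ℓ : Fin P.N) : Type := {p : Fin P.n // P.node p ∈ closure (P.sub ℓ)}

instance (ℓ : Fin P.N) : Fintype (P.LocalNode ℓ) := Fintype.ofFinite _

/-- The global system matrix `A_ε`. -/
def A (Ω ΓD : Set (E d)) : Matrix (Fin P.n) (Fin P.n) ℂ := P.helmholtz ΓD Ω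

/-- The local system matrix `A_{ε,ℓ}`. -/
def Aloc (ΓD : Set (E d)) (ℓ : Fin P.N) : Matrix (P.LocalNode ℓ) (P.LocalNode ℓ) ℂ :=
  (P.helmholtz ΓD (P.sub ℓ)).submatrix Subtype.val Subtype.val

/-- The global energy matrix `D_k`. -/
def D (Ω : Set (E d)) : Matrix (Fin P.n) (Fin P.n) ℂ := P.energy Ω

/-- The energy matrix `D_{k,ℓ}` of the subdomain `ℓ`, on the nodes of that subdomain. -/
def Dloc (ℓ : Fin P.N) : Matrix (P.LocalNode ℓ) (P.LocalNode ℓ) ℂ :=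
  (P.energy (P.sub ℓ)).submatrix Subtype.val Subtype.val

/-- The weighted restriction matrix `R_ℓ`, `(R_ℓ V)_p = χ_ℓ(x_p) V_p`. -/
def R (ℓ : Fin P.N) : Matrix (P.LocalNode ℓ) (Fin P.n) ℂ := fun p q =>
  if p.1 = q then (P.χ ℓ (P.node q) : ℂ) else 0

/-- The one-level additive Schwarz preconditioner `B_ε⁻¹ = ∑ R_ℓᵀ A_{ε,ℓ}⁻¹ R_ℓ`.
The matrix inverse is zero for a singular matrix. -/
def Binv (ΓD : Set (E d)) : Matrix (Fin P.n) (Fin P.n) ℂ :=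
  ∑ ℓ, (P.R ℓ).transpose * (P.Aloc ΓD ℓ)⁻¹ * P.R ℓ

end Discretisation

/-- The inner product `⟨V, W⟩_D = W^* D V`. -/
def ip {I : Type*} [Fintype I] (D : Matrix I I ℂ) (V W : I → ℂ) : ℂ :=
  star W ⬝ᵥ D.mulVec V

/-- The norm `‖V‖_D = ⟨V, V⟩_D^{1/2}`. -/
def nrm {I : Type*} [Fintype I] (D : Matrix I I ℂ) (V : I → ℂ) : ℝ := √(ip D V V).re

/-- The constants hidden in the assumptions on a family of problems. -/
structure Constants where
  /-- lower bound for the wavenumber -/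
  k₀ : ℝ
  /-- lower and upper bounds for `|η| / k` -/
  cη : ℝ
  Cη : ℝ
  /-- shape regularity of the meshes -/
  κ : ℝ
  /-- interpolation constant of the nodal bases -/
  Cint : ℝ
  /-- overlap constant -/
  b : ℝ
  /-- bound for the gradients of the partition of unity -/
  Cχ : ℝ
  /-- upper bound for `k h` -/
  Ch : ℝ
  /-- lower bound for `k δ` -/
  cδ : ℝ
  k₀_pos : 0 < k₀
  cη_pos : 0 < cη
  κ_pos : 0 < κ
  b_pos : 0 < b
  b_lt_one : b < 1
  cδ_pos : 0 < cδ

/-- The standing assumptions on a discretised Helmholtz problem on `Ω` with Dirichlet boundary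
`ΓD` and finite elements of degree `r - 1`, with hidden constants `c`. -/
structure Discretisation.Admissible {d : ℕ} (P : Discretisation d) (Ω ΓD : Set (E d)) (r : ℕ)
    (c : Constants) : Prop where
  -- the parameters
  k_ge : c.k₀ ≤ P.k
  ε_le : |P.ε| ≤ P.k ^ 2
  η_ge : c.cη * P.k ≤ ‖P.η‖
  η_le : ‖P.η‖ ≤ c.Cη * P.k
  -- the mesh: a finite, pure, shape-regular triangulation of the closed domain that resolves the
  -- Dirichlet boundary
  finite_mesh : P.mesh.faces.Finite
  pure : ∀ s ∈ P.mesh.faces, ∃ t ∈ P.elements, s ⊆ t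
  space_eq : P.mesh.space = closure Ω
  shape_regular : ∀ s ∈ P.elements, ∃ x,
    Metric.closedBall x (Metric.diam (cell s) / c.κ) ⊆ cell s
  dirichlet : ∃ F ⊆ {s | s ∈ P.mesh.faces ∧ s.card = d}, ΓD = ⋃ s ∈ F, cell s
  -- the nodal basis of the finite-element space
  node_mem : ∀ p, P.node p ∈ closure Ω
  φ_fe : ∀ p, P.IsFE Ω ΓD r (P.φ p)
  φ_node : ∀ p q, P.φ p (P.node q) = if p = q then 1 else 0
  φ_span : ∀ v, P.IsFE Ω ΓD r v → ∀ x ∈ closure Ω, v x = P.interp v x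
  -- the nodal basis has the approximation order of the finite-element space: on each element, the
  -- error is of order `h_τ^r |v|_{H^r(τ)}`; here `g` is a smooth representative of `v` on `τ`
  interp_error : ∀ s ∈ P.elements, ∀ v g : E d → ℝ, ContinuousOn v (closure Ω) →
    (∀ x ∈ ΓD, v x = 0) → ContDiff ℝ ∞ g → (∀ x ∈ cell s, v x = g x) →
    l2Norm (cell s) (v - P.interp v)
        + Metric.diam (cell s) * l2Norm (cell s) (gradient (v - P.interp v))
      ≤ c.Cint * Metric.diam (cell s) ^ r * l2Norm (cell s) (iteratedFDeriv ℝ r g)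
  -- the subdomains: open, non-empty unions of elements that cover the domain
  sub_open : ∀ ℓ, IsOpen (P.sub ℓ)
  sub_nonempty : ∀ ℓ, (P.sub ℓ).Nonempty
  sub_regular : ∀ ℓ, interior (closure (P.sub ℓ)) = P.sub ℓ
  sub_elements : ∀ ℓ, ∃ T ⊆ P.elements, closure (P.sub ℓ) = ⋃ s ∈ T, cell s
  cover : ⋃ ℓ, P.sub ℓ = Ω
  sub_impedance : ∀ ℓ, (frontier (P.sub ℓ) \ ΓD).Nonempty
  -- the overlap
  δℓ_pos : ∀ ℓ, 0 < P.δℓ ℓ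
  overlap_lower : ∀ ℓ, P.nearBoundary Ω ℓ (c.b * P.δℓ ℓ) ⊆ P.sub ℓ \ P.core ℓ
  overlap_upper : ∀ ℓ, P.sub ℓ \ P.core ℓ ⊆ P.nearBoundary Ω ℓ (P.δℓ ℓ)
  -- the partition of unity: continuous and piecewise linear
  χ_cont : ∀ ℓ, ContinuousOn (P.χ ℓ) (closure Ω)
  χ_linear : ∀ ℓ, ∀ s ∈ P.elements, IsPolyOn 1 (P.χ ℓ) (cell s)
  χ_mem : ∀ ℓ, ∀ x ∈ closure Ω, P.χ ℓ x ∈ Set.Icc (0 : ℝ) 1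
  χ_supp : ∀ ℓ, ∀ x ∈ closure Ω, P.χ ℓ x ≠ 0 → x ∈ closure (P.sub ℓ)
  χ_sum : ∀ x ∈ closure Ω, ∑ ℓ, P.χ ℓ x = 1
  χ_grad : ∀ ℓ, ∀ s ∈ P.elements, ∀ x ∈ interior (cell s),
    ‖gradient (P.χ ℓ) x‖ ≤ c.Cχ / P.δℓ ℓ
  -- resolution of the wavelength by the mesh, and of the overlap by the wavelength
  kh_le : P.k * P.h ≤ c.Ch
  kδ_ge : c.cδ ≤ P.k * P.δ

/-- The bound `‖A_{ε,ℓ}⁻¹ R_ℓ A_ε - R_ℓ‖ ≤ σ`. The matrix maps nodal vectors on the closed domain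
to nodal vectors on the closed subdomain `ℓ`; the energy norm over that subdomain is used both for
the image and for the argument (restricted to the nodes of the subdomain). -/
def Discretisation.LocalBound {d : ℕ} (P : Discretisation d) (Ω ΓD : Set (E d)) (ℓ : Fin P.N)
    (σ : ℝ) : Prop :=
  ∀ V : Fin P.n → ℂ,
    nrm (P.Dloc ℓ) (((P.Aloc ΓD ℓ)⁻¹ * P.R ℓ * P.A Ω ΓD - P.R ℓ).mulVec V)
      ≤ σ * nrm (P.Dloc ℓ) (fun p => V p.1)

end Schwarz

end

/-
In the energy norm, `B⁻¹ A = ∑ Q ℓ (Q ℓ + F ℓ)`, where `Q ℓ` multiplies nodal values by `χ ℓ` and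
the defect `F ℓ = A ℓ⁻¹ R ℓ A - R ℓ` is bounded by `σ`. Superapproximation shows that `Q ℓ` differs
from genuine multiplication by `χ ℓ` only by a relative error of order `1 / (k δ)`: on an element,
the derivatives of order `r` of `χ ℓ v` only contain one factor `∇χ ℓ = O(1 / δ)` and the top-order
derivatives of `v`, which an inverse inequality bounds by the energy of `v`. If `Q ℓ` were
multiplication by `χ ℓ`, then `∑ ⟨V, Q ℓ (Q ℓ V)⟩ = ∑ ‖χ ℓ V‖²`, which lies above `‖V‖² / Λ` by
Cauchy-Schwarz for `∑ χ ℓ = 1`; the remaining terms are controlled by the overlap bound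
`∑ ‖V‖_ℓ² ≤ Λ ‖V‖²`.
-/

noncomputable section

namespace Schwarz

/-! ### Polynomial functions -/

/-- Smooth functions all of whose derivatives of order larger than `m` vanish: the polynomial
functions of degree at most `m`, described by their derivatives. -/
def DegLE {V : Type*} [NormedAddCommGroup V] [NormedSpace ℝ V] (m : ℕ) (f : V → ℝ) : Prop :=
  ContDiff ℝ ∞ f ∧ ∀ j, m < j → ∀ x, iteratedFDeriv ℝ j f x = 0

namespace DegLE

variable {V : Type*} [NormedAddCommGroup V] [NormedSpace ℝ V] {m m' : ℕ} {f g : V → ℝ}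

lemma mono (hf : DegLE m f) (hm : m ≤ m') : DegLE m' f :=
  ⟨hf.1, fun j hj => hf.2 j (hm.trans_lt hj)⟩

protected lemma const (a : ℝ) : DegLE 0 (fun _ : V => a) :=
  ⟨contDiff_const, fun j hj x => by rw [iteratedFDeriv_const_of_ne hj.ne', Pi.zero_apply]⟩

lemma continuousLinearMap (L : V →L[ℝ] ℝ) : DegLE 1 L := by
  refine ⟨L.contDiff, fun j hj x => ?_⟩
  obtain ⟨i, rfl⟩ := Nat.exists_eq_add_one_of_ne_zero (Nat.ne_zero_of_lt hj)
  have hL : fderiv ℝ L = fun _ => L := funext fun _ => L.fderiv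
  rw [← norm_eq_zero, ← norm_iteratedFDeriv_fderiv, hL, iteratedFDeriv_const_of_ne (by omega),
    Pi.zero_apply, norm_zero]

lemma add (hf : DegLE m f) (hg : DegLE m g) : DegLE m (f + g) := by
  refine ⟨hf.1.add hg.1, fun j hj x => ?_⟩
  rw [iteratedFDeriv_add_apply (hf.1.contDiffAt.of_le (mod_cast le_top))
    (hg.1.contDiffAt.of_le (mod_cast le_top)), hf.2 j hj x, hg.2 j hj x, add_zero]

lemma mul (hf : DegLE m f) (hg : DegLE m' g) : DegLE (m + m') (f * g) := by
  refine ⟨hf.1.mul hg.1, fun j hj x => ?_⟩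
  rw [← norm_le_zero_iff]
  refine (norm_iteratedFDeriv_mul_le hf.1 hg.1 x (n := j) (mod_cast le_top)).trans
    (Finset.sum_nonpos fun i _ => ?_)
  by_cases hi : m < i
  · simp [hf.2 i hi x]
  · simp [hg.2 (j - i) (by omega) x]

lemma sum {α : Type*} {s : Finset α} {F : α → V → ℝ} (hF : ∀ i ∈ s, DegLE m (F i)) :
    DegLE m (∑ i ∈ s, F i) :=
  Finset.sum_induction F _ (fun _ _ => add) ((DegLE.const 0).mono m.zero_le) hF

lemma pow (hf : DegLE m f) (n : ℕ) : DegLE (n * m) (f ^ n) := by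
  induction n with
  | zero => simpa using! DegLE.const (V := V) 1
  | succ n ih =>
    rw [pow_succ, Nat.succ_mul]
    exact ih.mul hf

lemma prod {α : Type*} (s : Finset α) {F : α → V → ℝ} {b : α → ℕ} (hF : ∀ i, DegLE (b i) (F i)) :
    DegLE (∑ i ∈ s, b i) (∏ i ∈ s, F i) := by
  classical
  induction s using Finset.induction_on with
  | empty => simpa using! DegLE.const (V := V) 1
  | insert a s ha ih =>
    rw [Finset.prod_insert ha, Finset.sum_insert ha]
    exact (hF a).mul ih

lemma iteratedFDeriv_eq (hf : DegLE m f) (x y : V) :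
    iteratedFDeriv ℝ m f x = iteratedFDeriv ℝ m f y := by
  refine is_const_of_fderiv_eq_zero (𝕜 := ℝ)
    (hf.1.differentiable_iteratedFDeriv (mod_cast ENat.natCast_lt_top m)) (fun z => ?_) x y
  rw [← norm_eq_zero, norm_fderiv_iteratedFDeriv, hf.2 _ m.lt_succ_self, norm_zero]

/-- Only one term of the Leibniz formula survives. -/
lemma norm_iteratedFDeriv_affine_mul_le (hf : DegLE 1 f) (hg : DegLE m g) (x : V) :
    ‖iteratedFDeriv ℝ (m + 1) (f * g) x‖
      ≤ (m + 1) * (‖fderiv ℝ f x‖ * ‖iteratedFDeriv ℝ m g x‖) := by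
  refine (norm_iteratedFDeriv_mul_le hf.1 hg.1 x (n := m + 1) (mod_cast le_top)).trans_eq ?_
  rw [Finset.sum_eq_single 1]
  · rw [Nat.choose_one_right, norm_iteratedFDeriv_one, Nat.add_sub_cancel, mul_assoc]
    norm_cast
  · intro i _ hi
    rcases Nat.lt_or_gt_of_ne hi with h | h
    · obtain rfl : i = 0 := by omega
      simp [hg.2 (m + 1) m.lt_succ_self x]
    · simp [hf.2 i h x]
  · simp

end DegLE

lemma iteratedFDeriv_comp_add_smul {V F : Type*} [NormedAddCommGroup V] [NormedSpace ℝ V]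
    [NormedAddCommGroup F] [NormedSpace ℝ F] {m : ℕ} {f : V → F} (hf : ContDiff ℝ m f) (a : V)
    (ρ : ℝ) :
    iteratedFDeriv ℝ m (fun x => f (a + ρ • x)) 0 = ρ ^ m • iteratedFDeriv ℝ m f a := by
  have hcomp : (fun x => f (a + ρ • x))
      = (fun z => f (a + z)) ∘ (ρ • ContinuousLinearMap.id ℝ V) := by
    ext x
    simp
  have htranslate : ContDiff ℝ m (fun z => f (a + z)) := hf.comp (contDiff_const.add contDiff_id)
  rw [hcomp, ContinuousLinearMap.iteratedFDeriv_comp_right _ htranslate _ le_rfl,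
    iteratedFDeriv_comp_add_left]
  ext v
  simpa using (iteratedFDeriv ℝ m f a).map_smul_univ (fun _ => ρ) v

section polyFun

variable {d m : ℕ}

/-- The function on Euclidean space defined by a polynomial. -/
def polyFun : MvPolynomial (Fin d) ℝ →ₐ[ℝ] (E d → ℝ) := MvPolynomial.aeval fun i x => x i

lemma polyFun_apply (p : MvPolynomial (Fin d) ℝ) (x : E d) :
    polyFun p x = MvPolynomial.eval (fun i => x i) p := by
  induction p using MvPolynomial.induction_on with
  | C a => simp [polyFun]
  | add p q hp hq => simp only [map_add, Pi.add_apply, hp, hq]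
  | mul_X p i hp => simp only [map_mul, Pi.mul_apply, hp]; simp [polyFun]

lemma degLE_polyFun {p : MvPolynomial (Fin d) ℝ} (hp : p.totalDegree ≤ m) :
    DegLE m (polyFun p) := by
  have hexpand : polyFun p = ∑ t ∈ p.support,
      (fun _ => p.coeff t) * ∏ i, ⇑(EuclideanSpace.proj i : E d →L[ℝ] ℝ) ^ t i := by
    ext x
    simp [polyFun_apply, MvPolynomial.eval_eq']
  rw [hexpand]
  refine DegLE.sum fun t ht => ?_
  have hmonomial : DegLE (∑ i, t i * 1)
      (∏ i, ⇑(EuclideanSpace.proj i : E d →L[ℝ] ℝ) ^ t i) :=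
    DegLE.prod _ fun i => (DegLE.continuousLinearMap _).pow (t i)
  refine ((DegLE.const (p.coeff t)).mul hmonomial).mono ?_
  rw [zero_add]
  simpa [Finsupp.sum_fintype] using (MvPolynomial.le_totalDegree ht).trans hp

lemma contDiff_polyFun (p : MvPolynomial (Fin d) ℝ) : ContDiff ℝ ∞ (polyFun p) :=
  (degLE_polyFun le_rfl).1

lemma continuous_polyFun (p : MvPolynomial (Fin d) ℝ) : Continuous (polyFun p) :=
  (contDiff_polyFun p).continuous

lemma totalDegree_bind₁_le {α β A : Type*} [CommSemiring A] {f : α → MvPolynomial β A}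
    (hf : ∀ i, (f i).totalDegree ≤ 1) (p : MvPolynomial α A) :
    (MvPolynomial.bind₁ f p).totalDegree ≤ p.totalDegree := by
  rw [MvPolynomial.bind₁, MvPolynomial.aeval_def, MvPolynomial.eval₂_eq]
  refine MvPolynomial.totalDegree_finsetSum_le fun t ht => ?_
  refine (MvPolynomial.totalDegree_mul _ _).trans ?_
  rw [MvPolynomial.algebraMap_eq, MvPolynomial.totalDegree_C, zero_add]
  refine (MvPolynomial.totalDegree_finsetProd _ _).trans
    ((Finset.sum_le_sum fun i _ => ?_).trans (MvPolynomial.le_totalDegree ht))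
  simpa using (MvPolynomial.totalDegree_pow _ _).trans (Nat.mul_le_mul_left (t i) (hf i))

lemma exists_polyFun_comp_add_smul (p : MvPolynomial (Fin d) ℝ) (a : E d) (ρ : ℝ) :
    ∃ q : MvPolynomial (Fin d) ℝ, q.totalDegree ≤ p.totalDegree ∧
      polyFun q = fun x => polyFun p (a + ρ • x) := by
  refine ⟨MvPolynomial.bind₁ (fun i => MvPolynomial.C (a i) + MvPolynomial.C ρ * MvPolynomial.X i)
    p, totalDegree_bind₁_le (fun i => ?_) p, ?_⟩
  · refine (MvPolynomial.totalDegree_add _ _).trans (max_le (by simp) ?_)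
    exact (MvPolynomial.totalDegree_mul _ _).trans (by simp)
  · ext x
    rw [polyFun_apply, polyFun_apply, MvPolynomial.eval, MvPolynomial.eval₂Hom_bind₁]
    simp

end polyFun

/-! ### The `L²`-norm over a set -/

section l2Norm

variable {d : ℕ} {F G H : Type*} [NormedAddCommGroup F] [NormedAddCommGroup G]
  [NormedAddCommGroup H] {K : Set (E d)}

lemma l2Norm_nonneg (K : Set (E d)) (f : E d → F) : 0 ≤ l2Norm K f := Real.sqrt_nonneg _

lemma sq_l2Norm (K : Set (E d)) (f : E d → F) : l2Norm K f ^ 2 = ∫ x in K, ‖f x‖ ^ 2 :=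
  Real.sq_sqrt (integral_nonneg fun _ => sq_nonneg _)

lemma memLp_of_continuous (hK : IsCompact K) {f : E d → F} (hf : Continuous f) :
    MemLp f 2 (volume.restrict K) := by
  obtain ⟨C, hC⟩ := hK.exists_bound_of_continuousOn hf.continuousOn
  have : IsFiniteMeasure (volume.restrict K) :=
    isFiniteMeasure_restrict.2 hK.measure_lt_top.ne
  exact .of_bound hf.aestronglyMeasurable C (ae_restrict_of_forall_mem hK.measurableSet hC)

lemma norm_toLp_eq_l2Norm {f : E d → F} (hf : MemLp f 2 (volume.restrict K)) :
    ‖hf.toLp f‖ = l2Norm K f := by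
  rw [Lp.norm_toLp, hf.eLpNorm_eq_integral_rpow_norm (by norm_num) (by norm_num),
    ENNReal.toReal_ofReal (by positivity), l2Norm, Real.sqrt_eq_rpow]
  norm_num

lemma l2Norm_congr {f g : E d → F} (h : f =ᵐ[volume.restrict K] g) : l2Norm K f = l2Norm K g :=
  congrArg Real.sqrt (integral_congr_ae (h.mono fun x hx => by simp only [hx]))

lemma norm_eq_l2Norm_of_ae_eq {f : Lp F 2 (volume.restrict K)} {g : E d → F}
    (h : f =ᵐ[volume.restrict K] g) : ‖f‖ = l2Norm K g := by
  rw [← Lp.toLp_coeFn f (Lp.memLp f), norm_toLp_eq_l2Norm, l2Norm_congr h]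

lemma l2Norm_norm (K : Set (E d)) (f : E d → F) : l2Norm K (fun x => ‖f x‖) = l2Norm K f := by
  simp only [l2Norm, norm_norm]

lemma l2Norm_le_mul_of_norm_le {f : E d → F} {g : E d → G} {a : ℝ} (ha : 0 ≤ a)
    (hg : MemLp g 2 (volume.restrict K)) (h : ∀ᵐ x ∂volume.restrict K, ‖f x‖ ≤ a * ‖g x‖) :
    l2Norm K f ≤ a * l2Norm K g := by
  refine Real.sqrt_le_iff.2 ⟨mul_nonneg ha (l2Norm_nonneg _ _), ?_⟩
  rw [mul_pow, sq_l2Norm, ← integral_const_mul]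
  refine integral_mono_of_nonneg (.of_forall fun _ => sq_nonneg _)
    (hg.norm.integrable_sq.const_mul _) (h.mono fun x hx => ?_)
  simpa only [mul_pow] using pow_le_pow_left₀ (norm_nonneg _) hx 2

lemma l2Norm_le_add_of_norm_le {f : E d → F} {g : E d → G} {g' : E d → H}
    (hg : MemLp g 2 (volume.restrict K)) (hg' : MemLp g' 2 (volume.restrict K))
    (h : ∀ᵐ x ∂volume.restrict K, ‖f x‖ ≤ ‖g x‖ + ‖g' x‖) :
    l2Norm K f ≤ l2Norm K g + l2Norm K g' := by
  have hsum := hg.norm.add hg'.norm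
  calc l2Norm K f ≤ 1 * l2Norm K (fun x => ‖g x‖ + ‖g' x‖) :=
        l2Norm_le_mul_of_norm_le zero_le_one hsum (h.mono fun x hx => by
          rwa [one_mul, Real.norm_of_nonneg (by positivity)])
    _ = ‖hg.norm.toLp _ + hg'.norm.toLp _‖ := by
        rw [one_mul, ← MemLp.toLp_add, norm_toLp_eq_l2Norm hsum]
        rfl
    _ ≤ ‖hg.norm.toLp _‖ + ‖hg'.norm.toLp _‖ := norm_add_le _ _
    _ = l2Norm K g + l2Norm K g' := by
        rw [norm_toLp_eq_l2Norm, norm_toLp_eq_l2Norm, l2Norm_norm, l2Norm_norm]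

lemma setIntegral_unitClosedBall_comp_add_smul (f : E d → ℝ) (a : E d) {ρ : ℝ} (hρ : 0 < ρ) :
    ∫ x in Metric.closedBall 0 1, f (a + ρ • x)
      = (ρ ^ d)⁻¹ * ∫ x in Metric.closedBall a ρ, f x := by
  have htranslate := (measurePreserving_add_left volume a).setIntegral_preimage_emb
    (measurableEmbedding_addLeft a) f (Metric.closedBall a ρ)
  rw [Measure.setIntegral_comp_smul_of_pos volume (fun z => f (a + z)) _ hρ,
    finrank_euclideanSpace_fin, smul_unitClosedBall_of_nonneg hρ.le, smul_eq_mul, ← htranslate]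
  simp

lemma ae_eq_zero_of_l2Norm_eq_zero {f : E d → F} (hf : MemLp f 2 (volume.restrict K))
    (h : l2Norm K f = 0) :
    f =ᵐ[volume.restrict K] (0 : E d → F) := by
  have htoLp : hf.toLp f = 0 := norm_eq_zero.1 ((norm_toLp_eq_l2Norm hf).trans h)
  exact hf.coeFn_toLp.symm.trans ((Lp.eq_zero_iff_ae_eq_zero).1 htoLp)

end l2Norm

/-! ### The inverse inequality -/

lemma exists_norm_le_of_ker_le {V G H : Type*} [AddCommGroup V] [Module ℝ V]
    [FiniteDimensional ℝ V] [NormedAddCommGroup G] [NormedSpace ℝ G] [NormedAddCommGroup H]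
    [NormedSpace ℝ H] (T : V →ₗ[ℝ] H) (L : V →ₗ[ℝ] G)
    (hker : LinearMap.ker T ≤ LinearMap.ker L) :
    ∃ C : ℝ, ∀ v, ‖L v‖ ≤ C * ‖T v‖ := by
  obtain ⟨S, hS⟩ := T.rangeRestrict.exists_rightInverse_of_surjective T.range_rangeRestrict
  let B := (L ∘ₗ S).toContinuousLinearMap
  refine ⟨‖B‖, fun v => ?_⟩
  have hker_sub : S (T.rangeRestrict v) - v ∈ LinearMap.ker T := by
    rw [← T.ker_rangeRestrict, LinearMap.mem_ker, map_sub, sub_eq_zero]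
    exact LinearMap.congr_fun hS _
  have hfactor : L v = B (T.rangeRestrict v) := by
    rw [← sub_eq_zero, ← neg_eq_zero, neg_sub, ← LinearMap.mem_ker.1 (hker hker_sub), map_sub]
    rfl
  rw [hfactor]
  exact B.le_opNorm _

section inverseInequality

variable {d m : ℕ} {K : Set (E d)}

lemma memLp_polyFun (hK : IsCompact K) (p : MvPolynomial (Fin d) ℝ) :
    MemLp (polyFun p) 2 (volume.restrict K) :=
  memLp_of_continuous hK (continuous_polyFun p)

/-- The map sending a polynomial to its class in `L²(K)`. -/
def polyToLp (hK : IsCompact K) : MvPolynomial (Fin d) ℝ →ₗ[ℝ] Lp ℝ 2 (volume.restrict K) where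
  toFun p := (memLp_polyFun hK p).toLp
  map_add' p q := by simp only [map_add]; rfl
  map_smul' a p := by simp only [map_smul]; rfl

/-- The map sending a polynomial to its derivative of order `m` at the origin. -/
def polyIteratedFDeriv (d m : ℕ) :
    MvPolynomial (Fin d) ℝ →ₗ[ℝ] ContinuousMultilinearMap ℝ (fun _ : Fin m => E d) ℝ where
  toFun p := iteratedFDeriv ℝ m (polyFun p) 0
  map_add' p q := by
    rw [map_add, iteratedFDeriv_add_apply] <;>
      exact (contDiff_polyFun _).contDiffAt.of_le (mod_cast le_top)
  map_smul' a p := by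
    rw [map_smul, RingHom.id_apply, iteratedFDeriv_const_smul_apply]
    exact (contDiff_polyFun _).contDiffAt.of_le (mod_cast le_top)

lemma ker_polyToLp_unitBall_le_ker_polyIteratedFDeriv (d m : ℕ) :
    LinearMap.ker (polyToLp (isCompact_closedBall (0 : E d) 1))
      ≤ LinearMap.ker (polyIteratedFDeriv d m) := by
  intro p hp
  have hae : polyFun p =ᵐ[volume.restrict (Metric.closedBall 0 1)] 0 :=
    (MemLp.toLp_eq_toLp_iff (memLp_polyFun (isCompact_closedBall _ _) p) .zero).1 hp
  have hball : Set.EqOn (polyFun p) 0 (Metric.ball 0 1) :=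
    Measure.eqOn_open_of_ae_eq (μ := volume)
      (ae_restrict_of_ae_restrict_of_subset Metric.ball_subset_closedBall hae)
      Metric.isOpen_ball (continuous_polyFun p).continuousOn continuousOn_const
  have hgerm : polyFun p =ᶠ[𝓝 0] fun _ => 0 :=
    hball.eventuallyEq_of_mem (Metric.ball_mem_nhds _ one_pos)
  exact (hgerm.iteratedFDeriv ℝ m).eq_of_nhds.trans (congrFun iteratedFDeriv_fun_zero 0)

lemma exists_norm_iteratedFDeriv_zero_le (d m : ℕ) :
    ∃ C : ℝ, ∀ p : MvPolynomial (Fin d) ℝ, p.totalDegree ≤ m →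
      ‖iteratedFDeriv ℝ m (polyFun p) 0‖ ≤ C * l2Norm (Metric.closedBall 0 1) (polyFun p) := by
  let W := MvPolynomial.restrictTotalDegree (Fin d) ℝ m
  obtain ⟨C, hbound⟩ := exists_norm_le_of_ker_le
    (polyToLp (isCompact_closedBall (0 : E d) 1) ∘ₗ W.subtype)
    (polyIteratedFDeriv d m ∘ₗ W.subtype)
    fun p hp => ker_polyToLp_unitBall_le_ker_polyIteratedFDeriv d m hp
  refine ⟨C, fun p hp => ?_⟩
  rw [← norm_toLp_eq_l2Norm (memLp_polyFun (isCompact_closedBall _ _) p)]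
  exact hbound ⟨p, (MvPolynomial.mem_restrictTotalDegree _ _ _).2 hp⟩

lemma exists_sq_norm_iteratedFDeriv_center_le (d m : ℕ) :
    ∃ C : ℝ, 0 ≤ C ∧ ∀ (p : MvPolynomial (Fin d) ℝ) (x : E d) (ρ : ℝ),
      p.totalDegree ≤ m → 0 < ρ →
      ρ ^ d * (ρ ^ m * ‖iteratedFDeriv ℝ m (polyFun p) x‖) ^ 2
        ≤ C * l2Norm (Metric.closedBall x ρ) (polyFun p) ^ 2 := by
  obtain ⟨C, hunit⟩ := exists_norm_iteratedFDeriv_zero_le d m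
  refine ⟨C ^ 2, sq_nonneg C, fun p x ρ hp hρ => ?_⟩
  obtain ⟨q, hq, hqp⟩ := exists_polyFun_comp_add_smul p x ρ
  have hscaled := hunit q (hq.trans hp)
  rw [hqp, iteratedFDeriv_comp_add_smul ((contDiff_polyFun p).of_le (mod_cast le_top)), norm_smul,
    norm_pow, Real.norm_of_nonneg hρ.le] at hscaled
  calc ρ ^ d * (ρ ^ m * ‖iteratedFDeriv ℝ m (polyFun p) x‖) ^ 2
      ≤ ρ ^ d * (C * l2Norm (Metric.closedBall 0 1) fun y => polyFun p (x + ρ • y)) ^ 2 := by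
        gcongr
    _ = ρ ^ d * (C ^ 2 * ((ρ ^ d)⁻¹ * l2Norm (Metric.closedBall x ρ) (polyFun p) ^ 2)) := by
        rw [mul_pow, sq_l2Norm, sq_l2Norm,
          setIntegral_unitClosedBall_comp_add_smul (fun y => ‖polyFun p y‖ ^ 2) x hρ]
    _ = C ^ 2 * l2Norm (Metric.closedBall x ρ) (polyFun p) ^ 2 := by field_simp

lemma exists_inverse_inequality (d m : ℕ) {κ : ℝ} (hκ : 0 < κ) :
    ∃ C : ℝ, 0 ≤ C ∧ ∀ (p : MvPolynomial (Fin d) ℝ) (K : Set (E d)) (x : E d) (h : ℝ),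
      p.totalDegree ≤ m → IsCompact K → 0 < h → Metric.closedBall x (h / κ) ⊆ K →
      K ⊆ Metric.closedBall x h →
      h ^ m * l2Norm K (iteratedFDeriv ℝ m (polyFun p)) ≤ C * l2Norm K (polyFun p) := by
  obtain ⟨C, hC, hcenter⟩ := exists_sq_norm_iteratedFDeriv_center_le d m
  let v := volume.real (Metric.ball (0 : E d) 1)
  refine ⟨√(κ ^ (2 * m + d) * v * C), Real.sqrt_nonneg _, fun p K x h hp hK hh hball hKh => ?_⟩
  obtain ⟨ρ, hρ, rfl⟩ : ∃ ρ, 0 < ρ ∧ h = κ * ρ := ⟨h / κ, by positivity, by field_simp⟩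
  rw [mul_div_cancel_left₀ ρ hκ.ne'] at hball
  have hvolume : volume.real K ≤ (κ * ρ) ^ d * v := by
    refine (measureReal_mono hKh (isCompact_closedBall _ _).measure_lt_top.ne).trans_eq ?_
    rw [Measure.addHaar_real_closedBall _ _ hh.le, finrank_euclideanSpace_fin]
  have hmono : l2Norm (Metric.closedBall x ρ) (polyFun p) ^ 2 ≤ l2Norm K (polyFun p) ^ 2 := by
    rw [sq_l2Norm, sq_l2Norm]
    exact setIntegral_mono_set (memLp_polyFun hK p).norm.integrable_sq
      (.of_forall fun _ => sq_nonneg _) (.of_forall hball)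
  have hconst : l2Norm K (iteratedFDeriv ℝ m (polyFun p)) ^ 2
      = volume.real K * ‖iteratedFDeriv ℝ m (polyFun p) x‖ ^ 2 := by
    simp only [sq_l2Norm, fun y => (degLE_polyFun hp).iteratedFDeriv_eq y x, setIntegral_const,
      smul_eq_mul]
  refine le_of_sq_le_sq ?_ (mul_nonneg (Real.sqrt_nonneg _) (l2Norm_nonneg _ _))
  rw [mul_pow _ _ 2, mul_pow _ _ 2, Real.sq_sqrt (by positivity), hconst]
  calc ((κ * ρ) ^ m) ^ 2 * (volume.real K * ‖iteratedFDeriv ℝ m (polyFun p) x‖ ^ 2)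
      ≤ ((κ * ρ) ^ m) ^ 2 * ((κ * ρ) ^ d * v * ‖iteratedFDeriv ℝ m (polyFun p) x‖ ^ 2) := by
        gcongr
    _ = κ ^ (2 * m + d) * v * (ρ ^ d * (ρ ^ m * ‖iteratedFDeriv ℝ m (polyFun p) x‖) ^ 2) := by
        ring
    _ ≤ κ ^ (2 * m + d) * v * (C * l2Norm K (polyFun p) ^ 2) := by
        gcongr κ ^ (2 * m + d) * v * ?_
        exact (hcenter p x ρ hp hρ).trans (by gcongr)
    _ = κ ^ (2 * m + d) * v * C * l2Norm K (polyFun p) ^ 2 := by ring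

end inverseInequality

/-! ### Gradients and jets -/

section jet

variable {d : ℕ} {f g : E d → ℝ} {x : E d}

lemma gradient_congr (h : f =ᶠ[𝓝 x] g) : gradient f x = gradient g x := by
  simp only [gradient, h.fderiv_eq]

lemma norm_gradient (f : E d → ℝ) (x : E d) : ‖gradient f x‖ = ‖fderiv ℝ f x‖ := by
  simp only [gradient, LinearIsometryEquiv.norm_map]

lemma gradient_add (hf : DifferentiableAt ℝ f x) (hg : DifferentiableAt ℝ g x) :
    gradient (f + g) x = gradient f x + gradient g x := by
  simp only [gradient, fderiv_add hf hg, map_add]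

lemma gradient_const_smul (a : ℝ) (hf : DifferentiableAt ℝ f x) :
    gradient (a • f) x = a • gradient f x := by
  simp only [gradient, fderiv_const_smul hf, map_smul]

lemma gradient_mul (hf : DifferentiableAt ℝ f x) (hg : DifferentiableAt ℝ g x) :
    gradient (f * g) x = f x • gradient g x + g x • gradient f x := by
  simp only [gradient, fderiv_mul hf hg, map_add, map_smul]

lemma continuous_gradient (hf : ContDiff ℝ 1 f) : Continuous (gradient f) :=
  (LinearIsometryEquiv.continuous _).comp (hf.continuous_fderiv one_ne_zero)

/-- The pair `(∇f, k f)`, whose `L²`-norm is the Helmholtz energy norm of `f`. -/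
def jet (k : ℝ) (f : E d → ℝ) (x : E d) : WithLp 2 (E d × ℝ) :=
  WithLp.toLp 2 (gradient f x, k * f x)

lemma continuous_jet (k : ℝ) (hf : ContDiff ℝ 1 f) : Continuous (jet k f) :=
  (WithLp.prod_continuous_toLp 2 _ _).comp
    ((continuous_gradient hf).prodMk (continuous_const.mul hf.continuous))

lemma jet_congr (k : ℝ) (h : f =ᶠ[𝓝 x] g) : jet k f x = jet k g x := by
  simp only [jet, gradient_congr h, h.eq_of_nhds]

lemma jet_zero (k : ℝ) (x : E d) : jet k 0 x = 0 := by
  simp [jet, gradient]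

lemma jet_add (k : ℝ) (hf : DifferentiableAt ℝ f x) (hg : DifferentiableAt ℝ g x) :
    jet k (f + g) x = jet k f x + jet k g x := by
  simp only [jet, gradient_add hf hg, Pi.add_apply, mul_add, ← WithLp.toLp_add, Prod.mk_add_mk]

lemma jet_const_smul (k a : ℝ) (hf : DifferentiableAt ℝ f x) :
    jet k (a • f) x = a • jet k f x := by
  simp only [jet, gradient_const_smul a hf, Pi.smul_apply, mul_smul_comm, ← WithLp.toLp_smul,
    Prod.smul_mk]

lemma jet_mul (k : ℝ) (hf : DifferentiableAt ℝ f x) (hg : DifferentiableAt ℝ g x) :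
    jet k (f * g) x = f x • jet k g x + WithLp.toLp 2 (g x • gradient f x, 0) := by
  simp only [jet, gradient_mul hf hg, Pi.mul_apply, ← WithLp.toLp_smul, ← WithLp.toLp_add,
    Prod.smul_mk, Prod.mk_add_mk, smul_eq_mul, add_zero, mul_left_comm]

lemma norm_jet_le (k : ℝ) (f : E d → ℝ) (x : E d) :
    ‖jet k f x‖ ≤ ‖gradient f x‖ + ‖k • f x‖ := by
  rw [jet, WithLp.prod_norm_eq_of_L2]
  refine Real.sqrt_le_iff.2 ⟨by positivity, ?_⟩
  change ‖gradient f x‖ ^ 2 + ‖k • f x‖ ^ 2 ≤ _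
  nlinarith [norm_nonneg (gradient f x), norm_nonneg (k • f x)]

lemma norm_smul_le_norm_jet (k : ℝ) (f : E d → ℝ) (x : E d) : ‖k • f x‖ ≤ ‖jet k f x‖ := by
  rw [jet, WithLp.prod_norm_eq_of_L2]
  exact Real.le_sqrt_of_sq_le (le_add_of_nonneg_left (sq_nonneg _))

lemma inner_jet (k : ℝ) (f g : E d → ℝ) (x : E d) :
    inner ℝ (jet k f x) (jet k g x)
      = inner ℝ (gradient f x) (gradient g x) + k ^ 2 * (f x * g x) := by
  simp only [jet, WithLp.prod_inner_apply, RCLike.inner_apply, conj_trivial]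
  ring

end jet

lemma DegLE.l2Norm_iteratedFDeriv_affine_mul_le {d m : ℕ} {f g : E d → ℝ} {K : Set (E d)} {G : ℝ}
    (hf : DegLE 1 f) (hg : DegLE m g) (hK : IsCompact K) (hG : 0 ≤ G)
    (hgrad : ∀ᵐ x ∂volume.restrict K, ‖gradient f x‖ ≤ G) :
    l2Norm K (iteratedFDeriv ℝ (m + 1) (f * g))
      ≤ (m + 1) * G * l2Norm K (iteratedFDeriv ℝ m g) := by
  refine l2Norm_le_mul_of_norm_le (by positivity) (memLp_of_continuous hK
    (hg.1.continuous_iteratedFDeriv (mod_cast le_top))) (hgrad.mono fun x hx => ?_)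
  rw [norm_gradient] at hx
  refine (hf.norm_iteratedFDeriv_affine_mul_le hg x).trans ?_
  rw [mul_assoc]
  gcongr

/-! ### Piecewise polynomial functions -/

lemma ae_mem_interior {d : ℕ} {K : Set (E d)} (hK : Convex ℝ K) :
    ∀ᵐ x ∂volume.restrict K, x ∈ interior K := by
  have hfrontier : volume (frontier K) = 0 := hK.addHaar_frontier volume
  rw [ae_restrict_iff'₀ (hK.nullMeasurableSet volume)]
  filter_upwards [measure_eq_zero_iff_ae_notMem.1 hfrontier] with x hx hxK
  by_contra hint
  exact hx ⟨subset_closure hxK, hint⟩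

namespace IsPolyOn

variable {d a b m : ℕ} {f g : E d → ℝ} {K : Set (E d)}

lemma exists_eqOn_polyFun (hf : IsPolyOn m f K) :
    ∃ p : MvPolynomial (Fin d) ℝ, p.totalDegree ≤ m ∧ Set.EqOn f (polyFun p) K := by
  obtain ⟨p, hp, hfp⟩ := hf
  exact ⟨p, hp, fun x hx => (hfp x hx).trans (polyFun_apply p x).symm⟩

lemma exists_eventuallyEq_polyFun (hf : IsPolyOn m f K) :
    ∃ p : MvPolynomial (Fin d) ℝ, ∀ x ∈ interior K, f =ᶠ[𝓝 x] polyFun p := by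
  obtain ⟨p, -, hfp⟩ := hf.exists_eqOn_polyFun
  exact ⟨p, fun x hx => hfp.eventuallyEq_of_mem (mem_interior_iff_mem_nhds.1 hx)⟩

lemma differentiableAt (hf : IsPolyOn m f K) {x : E d} (hx : x ∈ interior K) :
    DifferentiableAt ℝ f x := by
  obtain ⟨p, hfp⟩ := hf.exists_eventuallyEq_polyFun
  exact (hfp x hx).differentiableAt_iff.2 ((contDiff_polyFun p).differentiable (by simp) x)

lemma mul (hf : IsPolyOn a f K) (hg : IsPolyOn b g K) : IsPolyOn (a + b) (f * g) K := by
  obtain ⟨p, hp, hfp⟩ := hf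
  obtain ⟨q, hq, hgq⟩ := hg
  refine ⟨p * q, (MvPolynomial.totalDegree_mul _ _).trans (add_le_add hp hq), fun x hx => ?_⟩
  rw [Pi.mul_apply, hfp x hx, hgq x hx, map_mul]

lemma sub (hf : IsPolyOn a f K) (hg : IsPolyOn b g K) : IsPolyOn (max a b) (f - g) K := by
  obtain ⟨p, hp, hfp⟩ := hf
  obtain ⟨q, hq, hgq⟩ := hg
  refine ⟨p - q, (MvPolynomial.totalDegree_sub _ _).trans (max_le_max hp hq), fun x hx => ?_⟩
  rw [Pi.sub_apply, hfp x hx, hgq x hx, map_sub]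

lemma const_smul (hf : IsPolyOn m f K) (t : ℝ) : IsPolyOn m (t • f) K := by
  obtain ⟨p, hp, hfp⟩ := hf
  refine ⟨t • p, (MvPolynomial.totalDegree_smul_le _ _).trans hp, fun x hx => ?_⟩
  rw [Pi.smul_apply, hfp x hx, MvPolynomial.smul_eval, smul_eq_mul]

lemma sum {α : Type*} {s : Finset α} {F : α → E d → ℝ} (hF : ∀ i ∈ s, IsPolyOn m (F i) K) :
    IsPolyOn m (∑ i ∈ s, F i) K := by
  have hzero : IsPolyOn m 0 K := ⟨0, by simp, by simp⟩
  refine Finset.sum_induction F (IsPolyOn m · K) (fun u v hu hv => ?_) hzero hF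
  obtain ⟨p, hp, hup⟩ := hu
  obtain ⟨q, hq, hvq⟩ := hv
  refine ⟨p + q, (MvPolynomial.totalDegree_add _ _).trans (max_le hp hq), fun x hx => ?_⟩
  rw [Pi.add_apply, hup x hx, hvq x hx, map_add]

lemma memLp (hf : IsPolyOn m f K) (hK : IsCompact K) : MemLp f 2 (volume.restrict K) := by
  obtain ⟨p, -, hfp⟩ := hf.exists_eqOn_polyFun
  exact (memLp_congr_ae (ae_restrict_of_forall_mem hK.measurableSet hfp)).2 (memLp_polyFun hK p)

lemma memLp_gradient (hf : IsPolyOn m f K) (hK : IsCompact K) (hKc : Convex ℝ K) :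
    MemLp (gradient f) 2 (volume.restrict K) := by
  obtain ⟨p, hfp⟩ := hf.exists_eventuallyEq_polyFun
  refine (memLp_congr_ae ((ae_mem_interior hKc).mono fun x hx => gradient_congr (hfp x hx))).2 ?_
  exact memLp_of_continuous hK (continuous_gradient ((contDiff_polyFun p).of_le (by simp)))

lemma memLp_jet (hf : IsPolyOn m f K) (hK : IsCompact K) (hKc : Convex ℝ K) (k : ℝ) :
    MemLp (jet k f) 2 (volume.restrict K) := by
  obtain ⟨p, hfp⟩ := hf.exists_eventuallyEq_polyFun
  refine (memLp_congr_ae ((ae_mem_interior hKc).mono fun x hx => jet_congr k (hfp x hx))).2 ?_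
  exact memLp_of_continuous hK (continuous_jet k ((contDiff_polyFun p).of_le (by simp)))

lemma l2Norm_jet_le (hf : IsPolyOn m f K) (hK : IsCompact K) (hKc : Convex ℝ K) {k : ℝ}
    (hk : 0 ≤ k) : l2Norm K (jet k f) ≤ l2Norm K (gradient f) + k * l2Norm K f := by
  have hkf : l2Norm K (k • f) ≤ k * l2Norm K f :=
    l2Norm_le_mul_of_norm_le hk (hf.memLp hK)
      (.of_forall fun x => by rw [Pi.smul_apply, norm_smul, Real.norm_of_nonneg hk])
  exact (l2Norm_le_add_of_norm_le (hf.memLp_gradient hK hKc) ((hf.memLp hK).const_smul k)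
    (.of_forall (norm_jet_le k f))).trans (add_le_add_right hkf _)

end IsPolyOn

/-! ### Additive Schwarz operators on Hilbert spaces -/

section splitting

variable {X H L : Type*} {K : L → Type*} [Fintype L] [AddCommGroup X] [Module ℝ X]
  [NormedAddCommGroup H] [InnerProductSpace ℝ H] [∀ ℓ, NormedAddCommGroup (K ℓ)]
  [∀ ℓ, InnerProductSpace ℝ (K ℓ)]

/-- An overlapping splitting of the energy space `X`, which carries the seminorm `‖J ·‖` and the
local seminorms `‖Jℓ ℓ ·‖`. The operator `Q ℓ` localises to the subdomain `ℓ`, and up to a relative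
error `θ` it acts on energies like the contraction `M ℓ`; the contractions form a partition of unity
in the sense of `cover`. -/
structure IsSplitting (J : X →ₗ[ℝ] H) (Jℓ : ∀ ℓ, X →ₗ[ℝ] K ℓ) (Q : L → X →ₗ[ℝ] X)
    (M : ∀ ℓ, X →ₗ[ℝ] K ℓ) (Λ θ : ℝ) : Prop where
  nonneg : 0 ≤ θ
  pos : 0 < Λ
  overlap : ∀ V, ∑ ℓ, ‖Jℓ ℓ V‖ ^ 2 ≤ Λ * ‖J V‖ ^ 2
  inner_localise : ∀ ℓ V W, inner ℝ (J V) (J (Q ℓ W)) = inner ℝ (Jℓ ℓ V) (Jℓ ℓ (Q ℓ W))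
  norm_le : ∀ ℓ V, ‖M ℓ V‖ ≤ ‖Jℓ ℓ V‖
  symm : ∀ ℓ V W, inner ℝ (Jℓ ℓ V) (M ℓ W) = inner ℝ (M ℓ V) (Jℓ ℓ W)
  norm_sub_le : ∀ ℓ V, ‖Jℓ ℓ (Q ℓ V) - M ℓ V‖ ≤ θ * ‖Jℓ ℓ V‖
  cover : ∀ V, ‖J V‖ ^ 2 ≤ Λ * ∑ ℓ, ‖M ℓ V‖ ^ 2

namespace IsSplitting

variable {J : X →ₗ[ℝ] H} {Jℓ : ∀ ℓ, X →ₗ[ℝ] K ℓ} {Q : L → X →ₗ[ℝ] X} {M : ∀ ℓ, X →ₗ[ℝ] K ℓ}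
  {Λ θ σ : ℝ} {F : L → X → X}

lemma norm_localise_le (h : IsSplitting J Jℓ Q M Λ θ) (ℓ : L) (V : X) :
    ‖Jℓ ℓ (Q ℓ V)‖ ≤ (1 + θ) * ‖Jℓ ℓ V‖ := by
  linarith [norm_sub_norm_le (Jℓ ℓ (Q ℓ V)) (M ℓ V), h.norm_sub_le ℓ V, h.norm_le ℓ V]

/-- A sum of localised functions has small energy if its terms do: by duality with the overlap
bound, since `J ∘ Q ℓ` only tests against `Jℓ ℓ`. -/
lemma sq_norm_sum_localise_le (h : IsSplitting J Jℓ Q M Λ θ) (U : L → X) :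
    ‖J (∑ ℓ, Q ℓ (U ℓ))‖ ^ 2 ≤ Λ * ∑ ℓ, ‖Jℓ ℓ (Q ℓ (U ℓ))‖ ^ 2 := by
  set S := ∑ ℓ, Q ℓ (U ℓ)
  set B := ∑ ℓ, ‖Jℓ ℓ (Q ℓ (U ℓ))‖ ^ 2
  have hpairing : ‖J S‖ ^ 2 ≤ ∑ ℓ, ‖Jℓ ℓ S‖ * ‖Jℓ ℓ (Q ℓ (U ℓ))‖ :=
    calc ‖J S‖ ^ 2 = ∑ ℓ, inner ℝ (J S) (J (Q ℓ (U ℓ))) := by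
          rw [← inner_sum, ← map_sum, real_inner_self_eq_norm_sq]
      _ ≤ ∑ ℓ, ‖Jℓ ℓ S‖ * ‖Jℓ ℓ (Q ℓ (U ℓ))‖ := Finset.sum_le_sum fun ℓ _ =>
          (h.inner_localise ℓ S (U ℓ)).trans_le (real_inner_le_norm _ _)
  have hsq : (‖J S‖ ^ 2) * ‖J S‖ ^ 2 ≤ (Λ * B) * ‖J S‖ ^ 2 :=
    calc (‖J S‖ ^ 2) * ‖J S‖ ^ 2 = (‖J S‖ ^ 2) ^ 2 := by ring
      _ ≤ (∑ ℓ, ‖Jℓ ℓ S‖ * ‖Jℓ ℓ (Q ℓ (U ℓ))‖) ^ 2 := by gcongr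
      _ ≤ (∑ ℓ, ‖Jℓ ℓ S‖ ^ 2) * B := Finset.sum_mul_sq_le_sq_mul_sq _ _ _
      _ ≤ Λ * ‖J S‖ ^ 2 * B := by
          gcongr
          exact h.overlap S
      _ = (Λ * B) * ‖J S‖ ^ 2 := by ring
  rcases (sq_nonneg ‖J S‖).eq_or_lt with hzero | hpos
  · exact hzero ▸ mul_nonneg h.pos.le (Finset.sum_nonneg fun _ _ => sq_nonneg _)
  · exact le_of_mul_le_mul_right hsq hpos

lemma norm_schwarz_le (h : IsSplitting J Jℓ Q M Λ θ) (hσ : 0 ≤ σ)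
    (hF : ∀ ℓ V, ‖Jℓ ℓ (F ℓ V)‖ ≤ σ * ‖Jℓ ℓ V‖) (V : X) :
    ‖J (∑ ℓ, Q ℓ (Q ℓ V + F ℓ V))‖ ≤ Λ * ((1 + θ) * (1 + θ + σ)) * ‖J V‖ := by
  have hθ := h.nonneg
  have hΛ := h.pos
  set b := (1 + θ) * (1 + θ + σ)
  have hlocal : ∀ ℓ, ‖Jℓ ℓ (Q ℓ (Q ℓ V + F ℓ V))‖ ≤ b * ‖Jℓ ℓ V‖ := fun ℓ =>
    calc ‖Jℓ ℓ (Q ℓ (Q ℓ V + F ℓ V))‖ ≤ (1 + θ) * ‖Jℓ ℓ (Q ℓ V) + Jℓ ℓ (F ℓ V)‖ := by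
          rw [← map_add (Jℓ ℓ)]
          exact h.norm_localise_le ℓ _
      _ ≤ (1 + θ) * ((1 + θ) * ‖Jℓ ℓ V‖ + σ * ‖Jℓ ℓ V‖) := by
          gcongr
          exact norm_add_le_of_le (h.norm_localise_le ℓ V) (hF ℓ V)
      _ = b * ‖Jℓ ℓ V‖ := by ring
  refine le_of_sq_le_sq ?_ (by positivity)
  calc ‖J (∑ ℓ, Q ℓ (Q ℓ V + F ℓ V))‖ ^ 2
      ≤ Λ * ∑ ℓ, ‖Jℓ ℓ (Q ℓ (Q ℓ V + F ℓ V))‖ ^ 2 := h.sq_norm_sum_localise_le _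
    _ ≤ Λ * ∑ ℓ, (b * ‖Jℓ ℓ V‖) ^ 2 := by
        gcongr with ℓ
        exact hlocal ℓ
    _ = Λ * b ^ 2 * ∑ ℓ, ‖Jℓ ℓ V‖ ^ 2 := by simp only [mul_pow, ← Finset.mul_sum, mul_assoc]
    _ ≤ Λ * b ^ 2 * (Λ * ‖J V‖ ^ 2) := by
        gcongr
        exact h.overlap V
    _ = (Λ * b * ‖J V‖) ^ 2 := by ring

lemma le_inner_localise_localise (h : IsSplitting J Jℓ Q M Λ θ) (ℓ : L) (V : X) :
    ‖M ℓ V‖ ^ 2 - θ * (2 + θ) * ‖Jℓ ℓ V‖ ^ 2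
      ≤ inner ℝ (Jℓ ℓ V) (Jℓ ℓ (Q ℓ (Q ℓ V))) := by
  have hsplit : inner ℝ (Jℓ ℓ V) (Jℓ ℓ (Q ℓ (Q ℓ V)))
      = inner ℝ (Jℓ ℓ V) (Jℓ ℓ (Q ℓ (Q ℓ V)) - M ℓ (Q ℓ V))
        + inner ℝ (M ℓ V) (Jℓ ℓ (Q ℓ V) - M ℓ V) + ‖M ℓ V‖ ^ 2 := by
    rw [inner_sub_right, inner_sub_right, h.symm, real_inner_self_eq_norm_sq]
    ring
  have houter : ‖Jℓ ℓ V‖ * ‖Jℓ ℓ (Q ℓ (Q ℓ V)) - M ℓ (Q ℓ V)‖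
      ≤ ‖Jℓ ℓ V‖ * (θ * ((1 + θ) * ‖Jℓ ℓ V‖)) := by
    have := h.nonneg
    gcongr
    exact (h.norm_sub_le ℓ (Q ℓ V)).trans (by gcongr; exact h.norm_localise_le ℓ V)
  have hinner : ‖M ℓ V‖ * ‖Jℓ ℓ (Q ℓ V) - M ℓ V‖ ≤ ‖Jℓ ℓ V‖ * (θ * ‖Jℓ ℓ V‖) := by
    gcongr
    exacts [h.norm_le ℓ V, h.norm_sub_le ℓ V]
  linarith [neg_le_of_abs_le (abs_real_inner_le_norm (Jℓ ℓ V) (Jℓ ℓ (Q ℓ (Q ℓ V)) - M ℓ (Q ℓ V))),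
    neg_le_of_abs_le (abs_real_inner_le_norm (M ℓ V) (Jℓ ℓ (Q ℓ V) - M ℓ V))]

lemma le_inner_localise_defect (h : IsSplitting J Jℓ Q M Λ θ)
    (hF : ∀ ℓ V, ‖Jℓ ℓ (F ℓ V)‖ ≤ σ * ‖Jℓ ℓ V‖) (ℓ : L) (V : X) :
    -((1 + θ) * σ * ‖Jℓ ℓ V‖ ^ 2) ≤ inner ℝ (Jℓ ℓ V) (Jℓ ℓ (Q ℓ (F ℓ V))) := by
  have hθ := h.nonneg
  refine neg_le_of_abs_le ((abs_real_inner_le_norm _ _).trans ?_)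
  calc ‖Jℓ ℓ V‖ * ‖Jℓ ℓ (Q ℓ (F ℓ V))‖ ≤ ‖Jℓ ℓ V‖ * ((1 + θ) * (σ * ‖Jℓ ℓ V‖)) := by
        gcongr
        exact (h.norm_localise_le ℓ _).trans (by gcongr; exact hF ℓ V)
    _ = (1 + θ) * σ * ‖Jℓ ℓ V‖ ^ 2 := by ring

lemma le_inner_schwarz (h : IsSplitting J Jℓ Q M Λ θ) (hσ : 0 ≤ σ)
    (hF : ∀ ℓ V, ‖Jℓ ℓ (F ℓ V)‖ ≤ σ * ‖Jℓ ℓ V‖) (V : X) :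
    (1 / Λ - Λ * (θ * (2 + θ) + (1 + θ) * σ)) * ‖J V‖ ^ 2
      ≤ inner ℝ (J V) (J (∑ ℓ, Q ℓ (Q ℓ V + F ℓ V))) := by
  have hθ := h.nonneg
  set t := θ * (2 + θ) + (1 + θ) * σ with ht
  have hlocal : ∀ ℓ, ‖M ℓ V‖ ^ 2 - t * ‖Jℓ ℓ V‖ ^ 2
      ≤ inner ℝ (J V) (J (Q ℓ (Q ℓ V + F ℓ V))) := fun ℓ => by
    rw [h.inner_localise, map_add, map_add, inner_add_right, ht]
    linarith [h.le_inner_localise_localise ℓ V, h.le_inner_localise_defect hF ℓ V]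
  calc (1 / Λ - Λ * t) * ‖J V‖ ^ 2 = ‖J V‖ ^ 2 / Λ - t * (Λ * ‖J V‖ ^ 2) := by ring
    _ ≤ ∑ ℓ, ‖M ℓ V‖ ^ 2 - t * ∑ ℓ, ‖Jℓ ℓ V‖ ^ 2 :=
        sub_le_sub ((div_le_iff₀' h.pos).2 (h.cover V))
          (mul_le_mul_of_nonneg_left (h.overlap V) (by positivity))
    _ = ∑ ℓ, (‖M ℓ V‖ ^ 2 - t * ‖Jℓ ℓ V‖ ^ 2) := by
        rw [Finset.sum_sub_distrib, Finset.mul_sum]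
    _ ≤ inner ℝ (J V) (J (∑ ℓ, Q ℓ (Q ℓ V + F ℓ V))) := by
        rw [map_sum, inner_sum]
        exact Finset.sum_le_sum fun ℓ _ => hlocal ℓ

end IsSplitting

end splitting

/-! ### Complex nodal vectors -/

section complexification

variable {I H H' : Type*} [NormedAddCommGroup H] [InnerProductSpace ℝ H]
  [NormedAddCommGroup H'] [InnerProductSpace ℝ H']

/-- The map `V ↦ (j (re V), j (im V))`, which turns a real energy inner product into the real part
of its complexification. -/
def complexify (j : (I → ℝ) →ₗ[ℝ] H) : (I → ℂ) →ₗ[ℝ] WithLp 2 (H × H) :=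
  (WithLp.linearEquiv 2 ℝ (H × H)).symm.toLinearMap ∘ₗ
    (j ∘ₗ Complex.reLm.compLeft I).prod (j ∘ₗ Complex.imLm.compLeft I)

lemma inner_complexify (i j : (I → ℝ) →ₗ[ℝ] H) (V W : I → ℂ) :
    inner ℝ (complexify i V) (complexify j W)
      = inner ℝ (i (Complex.re ∘ V)) (j (Complex.re ∘ W))
        + inner ℝ (i (Complex.im ∘ V)) (j (Complex.im ∘ W)) := rfl

lemma sq_norm_complexify (j : (I → ℝ) →ₗ[ℝ] H) (V : I → ℂ) :
    ‖complexify j V‖ ^ 2 = ‖j (Complex.re ∘ V)‖ ^ 2 + ‖j (Complex.im ∘ V)‖ ^ 2 :=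
  WithLp.prod_norm_sq_eq_of_L2 _

lemma norm_complexify_le {i : (I → ℝ) →ₗ[ℝ] H} {j : (I → ℝ) →ₗ[ℝ] H'} {a : ℝ} (ha : 0 ≤ a)
    (h : ∀ x, ‖i x‖ ≤ a * ‖j x‖) (V : I → ℂ) : ‖complexify i V‖ ≤ a * ‖complexify j V‖ := by
  refine le_of_sq_le_sq ?_ (by positivity)
  rw [mul_pow, sq_norm_complexify, sq_norm_complexify, mul_add, ← mul_pow, ← mul_pow]
  gcongr <;> exact h _

lemma complexify_injective {j : (I → ℝ) →ₗ[ℝ] H} (hj : Function.Injective j) :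
    Function.Injective (complexify j) := fun V W h => by
  obtain ⟨hre, him⟩ := Prod.mk.inj ((WithLp.toLp_injective 2) h)
  exact funext fun p => Complex.ext (congrFun (hj hre) p) (congrFun (hj him) p)

lemma IsSplitting.complexify {L : Type*} {K : L → Type*} [Fintype L]
    [∀ ℓ, NormedAddCommGroup (K ℓ)] [∀ ℓ, InnerProductSpace ℝ (K ℓ)] {J : (I → ℝ) →ₗ[ℝ] H}
    {Jℓ : ∀ ℓ, (I → ℝ) →ₗ[ℝ] K ℓ} {w : L → I → ℝ} {M : ∀ ℓ, (I → ℝ) →ₗ[ℝ] K ℓ} {Λ θ : ℝ}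
    (h : IsSplitting J Jℓ (fun ℓ => LinearMap.mulLeft ℝ (w ℓ)) M Λ θ) :
    IsSplitting (Schwarz.complexify J) (fun ℓ => Schwarz.complexify (Jℓ ℓ))
      (fun ℓ => LinearMap.mulLeft ℝ fun p => (w ℓ p : ℂ)) (fun ℓ => Schwarz.complexify (M ℓ))
      Λ θ := by
  have hre : ∀ ℓ (V : I → ℂ), Complex.re ∘ ((fun p => (w ℓ p : ℂ)) * V) = w ℓ * Complex.re ∘ V :=
    fun ℓ V => funext fun p => Complex.re_ofReal_mul _ _
  have him : ∀ ℓ (V : I → ℂ), Complex.im ∘ ((fun p => (w ℓ p : ℂ)) * V) = w ℓ * Complex.im ∘ V :=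
    fun ℓ V => funext fun p => Complex.im_ofReal_mul _ _
  have hinner : ∀ ℓ V W, inner ℝ (J V) (J (w ℓ * W)) = inner ℝ (Jℓ ℓ V) (Jℓ ℓ (w ℓ * W)) :=
    h.inner_localise
  refine ⟨h.nonneg, h.pos, fun V => ?_, fun ℓ V W => ?_, fun ℓ V => ?_, fun ℓ V W => ?_,
    fun ℓ V => ?_, fun V => ?_⟩
  · simp only [sq_norm_complexify, Finset.sum_add_distrib, mul_add]
    exact add_le_add (h.overlap _) (h.overlap _)
  · simp only [inner_complexify, LinearMap.mulLeft_apply, hre, him, hinner]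
  · simpa using norm_complexify_le zero_le_one (by simpa using h.norm_le ℓ) V
  · simp only [inner_complexify, h.symm]
  · have hsub : Schwarz.complexify (Jℓ ℓ) (LinearMap.mulLeft ℝ (fun p => (w ℓ p : ℂ)) V)
        - Schwarz.complexify (M ℓ) V
        = Schwarz.complexify (Jℓ ℓ ∘ₗ LinearMap.mulLeft ℝ (w ℓ) - M ℓ) V :=
      congrArg (WithLp.toLp 2) (Prod.ext
        (congrArg (Jℓ ℓ · - M ℓ (Complex.re ∘ V)) (hre ℓ V))
        (congrArg (Jℓ ℓ · - M ℓ (Complex.im ∘ V)) (him ℓ V)))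
    rw [hsub]
    exact norm_complexify_le h.nonneg (h.norm_sub_le ℓ) V
  · simp only [sq_norm_complexify, Finset.sum_add_distrib, mul_add]
    exact add_le_add (h.cover _) (h.cover _)

variable [Fintype I]

lemma re_ip_map_ofReal (G : Matrix I I ℝ) (V W : I → ℂ) :
    (ip (G.map fun t => (t : ℂ)) V W).re
      = (Complex.re ∘ W) ⬝ᵥ G.mulVec (Complex.re ∘ V)
        + (Complex.im ∘ W) ⬝ᵥ G.mulVec (Complex.im ∘ V) := by
  simp [ip, dotProduct, Matrix.mulVec, Finset.mul_sum, ← Finset.sum_add_distrib]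

lemma dotProduct_gram_mulVec [DecidableEq I] (j : (I → ℝ) →ₗ[ℝ] H) (x y : I → ℝ) :
    x ⬝ᵥ (Matrix.gram ℝ fun p => j (Pi.single p 1)).mulVec y = inner ℝ (j x) (j y) := by
  have hsum : ∀ z, ∑ p, z p • j (Pi.single p 1) = j z := fun z => by
    simp only [← map_smul, ← map_sum, ← pi_eq_sum_univ']
  rw [← hsum x, ← hsum y]
  exact Matrix.star_dotProduct_gram_mulVec (𝕜 := ℝ) (fun p => j (Pi.single p 1)) x y

lemma re_ip_gram [DecidableEq I] (j : (I → ℝ) →ₗ[ℝ] H) (V W : I → ℂ) :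
    (ip ((Matrix.gram ℝ fun p => j (Pi.single p 1)).map fun t => (t : ℂ)) V W).re
      = inner ℝ (complexify j W) (complexify j V) := by
  rw [re_ip_map_ofReal, dotProduct_gram_mulVec, dotProduct_gram_mulVec, inner_complexify]

lemma nrm_gram [DecidableEq I] (j : (I → ℝ) →ₗ[ℝ] H) (V : I → ℂ) :
    nrm ((Matrix.gram ℝ fun p => j (Pi.single p 1)).map fun t => (t : ℂ)) V
      = ‖complexify j V‖ := by
  rw [nrm, re_ip_gram, real_inner_self_eq_norm_sq, Real.sqrt_sq (norm_nonneg _)]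

end complexification

section submatrix

variable {I I' : Type*} [Fintype I] [Fintype I'] {f : I' → I}

lemma extend_zero_dotProduct {R : Type*} [NonUnitalNonAssocSemiring R]
    (hf : Function.Injective f) (x : I' → R) (y : I → R) :
    Function.extend f x 0 ⬝ᵥ y = x ⬝ᵥ (y ∘ f) := by
  refine (Fintype.sum_of_injective f hf _ _ (fun p hp => ?_) fun q => ?_).symm
  · rw [Function.extend_apply' _ _ _ hp, Pi.zero_apply, zero_mul]
  · rw [hf.extend_apply, Function.comp_apply]

lemma ip_submatrix (hf : Function.Injective f) (D : Matrix I I ℂ) (X Y : I' → ℂ) :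
    ip (D.submatrix f f) X Y = ip D (Function.extend f X 0) (Function.extend f Y 0) := by
  have hmulVec : (D.submatrix f f).mulVec X = D.mulVec (Function.extend f X 0) ∘ f :=
    funext fun q => by
      have h := extend_zero_dotProduct hf X (D (f q))
      rw [dotProduct_comm, dotProduct_comm X] at h
      exact h.symm
  have hstar : star (Function.extend f Y 0) = Function.extend f (star Y) 0 := by
    ext p
    by_cases hp : ∃ q, f q = p
    · obtain ⟨q, rfl⟩ := hp
      simp only [Pi.star_apply, hf.extend_apply]
    · simp only [Pi.star_apply, Function.extend_apply' _ _ _ hp, Pi.zero_apply, star_zero]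
  rw [ip, ip, hstar, extend_zero_dotProduct hf, hmulVec]

lemma nrm_submatrix (hf : Function.Injective f) (D : Matrix I I ℂ) (X : I' → ℂ) :
    nrm (D.submatrix f f) X = nrm D (Function.extend f X 0) := by
  rw [nrm, nrm, ip_submatrix hf]

end submatrix

namespace Discretisation

variable {d : ℕ} {P : Discretisation d} {Ω ΓD U : Set (E d)} {r : ℕ} {c : Constants}
  {s t : Finset (E d)} {x : E d} {σ θ : ℝ}

/-! ### Elements of the mesh -/

lemma convex_cell (s : Finset (E d)) : Convex ℝ (cell s) := convex_convexHull ℝ _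

lemma isCompact_cell (s : Finset (E d)) : IsCompact (cell s) :=
  s.finite_toSet.isCompact_convexHull ℝ

lemma measurableSet_cell (s : Finset (E d)) : MeasurableSet (cell s) :=
  (isCompact_cell s).measurableSet

lemma diam_cell_pos (hd : 0 < d) (hs : s ∈ P.elements) : 0 < Metric.diam (cell s) := by
  obtain ⟨a, ha, b, hb, hab⟩ := Finset.one_lt_card.1 (hs.2 ▸ Nat.lt_add_of_pos_left hd)
  exact (dist_pos.2 hab).trans_le (Metric.dist_le_diam_of_mem (isCompact_cell s).isBounded
    (subset_convexHull ℝ _ ha) (subset_convexHull ℝ _ hb))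

namespace Admissible

lemma k_pos (hP : P.Admissible Ω ΓD r c) : 0 < P.k := c.k₀_pos.trans_le hP.k_ge

lemma exists_closedBall_subset_cell (hP : P.Admissible Ω ΓD r c) (hs : s ∈ P.elements) :
    ∃ x, Metric.closedBall x (Metric.diam (cell s) / c.κ) ⊆ cell s ∧
      cell s ⊆ Metric.closedBall x (Metric.diam (cell s)) := by
  obtain ⟨x, hx⟩ := hP.shape_regular s hs
  have hxs : x ∈ cell s :=
    hx (Metric.mem_closedBall_self (div_nonneg Metric.diam_nonneg c.κ_pos.le))
  exact ⟨x, hx, fun y hy => Metric.dist_le_diam_of_mem (isCompact_cell s).isBounded hy hxs⟩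

lemma closure_interior_cell (hP : P.Admissible Ω ΓD r c) (hd : 0 < d) (hs : s ∈ P.elements) :
    closure (interior (cell s)) = cell s := by
  obtain ⟨x, hx, -⟩ := hP.exists_closedBall_subset_cell hs
  have hx_int : x ∈ interior (cell s) := mem_interior_iff_mem_nhds.2
    (mem_of_superset (Metric.closedBall_mem_nhds x (div_pos (diam_cell_pos hd hs) c.κ_pos)) hx)
  rw [(convex_cell s).closure_interior_eq_closure_of_nonempty_interior ⟨x, hx_int⟩,
    (isCompact_cell s).isClosed.closure_eq]

lemma cell_subset (hP : P.Admissible Ω ΓD r c) (hs : s ∈ P.elements) : cell s ⊆ closure Ω :=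
  hP.space_eq ▸ P.mesh.convexHull_subset_space hs.1

lemma finite_elements (hP : P.Admissible Ω ΓD r c) : P.elements.Finite :=
  hP.finite_mesh.subset fun _ h => h.1

lemma diam_cell_le_h (hP : P.Admissible Ω ΓD r c) (hs : s ∈ P.elements) :
    Metric.diam (cell s) ≤ P.h :=
  le_csSup (hP.finite_elements.image _).bddAbove ⟨s, hs, rfl⟩

end Admissible

/-! ### Superapproximation -/

/-- The finite-element function with the given nodal values. -/
def fe (P : Discretisation d) : (Fin P.n → ℝ) →ₗ[ℝ] (E d → ℝ) := Fintype.linearCombination ℝ P.φ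

lemma fe_apply (W : Fin P.n → ℝ) (x : E d) : P.fe W x = ∑ p, W p * P.φ p x := by
  simp [fe, Fintype.linearCombination_apply]

lemma fe_single (p : Fin P.n) : P.fe (Pi.single p 1) = P.φ p := by
  rw [fe, Fintype.linearCombination_apply_single, one_smul]

lemma interp_eq_fe (v : E d → ℝ) : P.interp v = P.fe (v ∘ P.node) :=
  funext fun x => (fe_apply _ x).symm

namespace Admissible

lemma isPolyOn_fe (hP : P.Admissible Ω ΓD r c) (hs : s ∈ P.elements) (W : Fin P.n → ℝ) :
    IsPolyOn (r - 1) (P.fe W) (cell s) := by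
  rw [fe, Fintype.linearCombination_apply]
  exact IsPolyOn.sum fun p _ => ((hP.φ_fe p).2.1 s hs).const_smul (W p)

lemma memLp_jet_fe_cell (hP : P.Admissible Ω ΓD r c) (hs : s ∈ P.elements) (k : ℝ)
    (W : Fin P.n → ℝ) : MemLp (jet k (P.fe W)) 2 (volume.restrict (cell s)) :=
  (hP.isPolyOn_fe hs W).memLp_jet (isCompact_cell s) (convex_cell s) k

lemma continuousOn_fe (hP : P.Admissible Ω ΓD r c) (W : Fin P.n → ℝ) :
    ContinuousOn (P.fe W) (closure Ω) := by
  rw [funext (fe_apply W)]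
  exact continuousOn_finsetSum _ fun p _ => continuousOn_const.mul (hP.φ_fe p).1

lemma fe_dirichlet (hP : P.Admissible Ω ΓD r c) (W : Fin P.n → ℝ) {x : E d} (hx : x ∈ ΓD) :
    P.fe W x = 0 := by
  rw [fe_apply]
  exact Finset.sum_eq_zero fun p _ => by rw [(hP.φ_fe p).2.2 x hx, mul_zero]

lemma fe_node (hP : P.Admissible Ω ΓD r c) (W : Fin P.n → ℝ) (q : Fin P.n) :
    P.fe W (P.node q) = W q := by
  simp [fe_apply, hP.φ_node]

lemma interp_mul_fe (hP : P.Admissible Ω ΓD r c) (f : E d → ℝ) (W : Fin P.n → ℝ) :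
    P.interp (f * P.fe W) = P.fe (f ∘ P.node * W) := by
  rw [interp_eq_fe]
  congr 1
  ext q
  simp [hP.fe_node]

lemma isPolyOn_interp_error (hP : P.Admissible Ω ΓD r c) (hs : s ∈ P.elements) {f : E d → ℝ}
    (hf : IsPolyOn 1 f (cell s)) (W : Fin P.n → ℝ) :
    IsPolyOn (1 + (r - 1)) (f * P.fe W - P.interp (f * P.fe W)) (cell s) := by
  have h := (hf.mul (hP.isPolyOn_fe hs W)).sub (hP.isPolyOn_fe hs ((f * P.fe W) ∘ P.node))
  rwa [max_eq_left (Nat.le_add_left _ _), ← interp_eq_fe] at h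

lemma jet_fe_mul_sub (hP : P.Admissible Ω ΓD r c) (hs : s ∈ P.elements) {f : E d → ℝ}
    (hf : IsPolyOn 1 f (cell s)) (W : Fin P.n → ℝ) {x : E d} (hx : x ∈ interior (cell s)) :
    jet P.k (P.fe (f ∘ P.node * W)) x - f x • jet P.k (P.fe W) x
      = WithLp.toLp 2 (P.fe W x • gradient f x, 0)
        - jet P.k (f * P.fe W - P.interp (f * P.fe W)) x := by
  have hw := (hP.isPolyOn_fe hs W).differentiableAt hx
  have he := (hP.isPolyOn_interp_error hs hf W).differentiableAt hx
  have hsplit : P.fe (f ∘ P.node * W)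
      = f * P.fe W + (-1 : ℝ) • (f * P.fe W - P.interp (f * P.fe W)) := by
    rw [hP.interp_mul_fe]
    module
  rw [hsplit, jet_add P.k ((hf.differentiableAt hx).mul hw) (he.const_smul _),
    jet_const_smul _ _ he, jet_mul P.k (hf.differentiableAt hx) hw]
  module

end Admissible

/-- The multipliers of the superapproximation estimate: `f` is continuous on the closed domain and
affine on the element `s`, where its slope is at most `G`. -/
structure IsAffineWeight {d : ℕ} (Ω : Set (E d)) (s : Finset (E d)) (f : E d → ℝ) (G : ℝ) :
    Prop where
  continuousOn : ContinuousOn f (closure Ω)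
  isPolyOn : IsPolyOn 1 f (cell s)
  nonneg : 0 ≤ G
  norm_gradient_le : ∀ x ∈ interior (cell s), ‖gradient f x‖ ≤ G

lemma exists_interp_affine_mul_error {d : ℕ} (hd : 0 < d) (m : ℕ) (c : Constants) :
    ∃ C : ℝ, 0 ≤ C ∧ ∀ (Ω ΓD : Set (E d)) (P : Discretisation d), P.Admissible Ω ΓD (m + 1) c →
      ∀ s ∈ P.elements, ∀ f G, IsAffineWeight Ω s f G → ∀ W : Fin P.n → ℝ,
      l2Norm (cell s) (f * P.fe W - P.interp (f * P.fe W)) + Metric.diam (cell s)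
          * l2Norm (cell s) (gradient (f * P.fe W - P.interp (f * P.fe W)))
        ≤ Metric.diam (cell s) * (C * (G * l2Norm (cell s) (P.fe W))) := by
  obtain ⟨C, hC, hinverse⟩ := exists_inverse_inequality d m c.κ_pos
  refine ⟨|c.Cint| * ((m + 1) * C), by positivity, fun Ω ΓD P hP s hs f G hf W => ?_⟩
  set h := Metric.diam (cell s)
  have hh : 0 < h := diam_cell_pos hd hs
  have hG := hf.nonneg
  obtain ⟨x, hball, hball'⟩ := hP.exists_closedBall_subset_cell hs
  obtain ⟨p, hp, hfp⟩ := hf.isPolyOn.exists_eqOn_polyFun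
  obtain ⟨q, hq, hWq⟩ := (hP.isPolyOn_fe hs W).exists_eqOn_polyFun
  rw [Nat.add_sub_cancel] at hq
  have hproduct := (degLE_polyFun hp).l2Norm_iteratedFDeriv_affine_mul_le (degLE_polyFun hq)
    (isCompact_cell s) hG ((ae_mem_interior (convex_cell s)).mono fun y hy =>
      gradient_congr (hfp.eventuallyEq_of_mem (mem_interior_iff_mem_nhds.1 hy)) ▸
        hf.norm_gradient_le y hy)
  have hnorm : l2Norm (cell s) (P.fe W) = l2Norm (cell s) (polyFun q) :=
    l2Norm_congr (ae_restrict_of_forall_mem (measurableSet_cell s) hWq)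
  refine (hP.interp_error s hs (f * P.fe W) (polyFun p * polyFun q)
    (hf.continuousOn.mul (hP.continuousOn_fe W)) (fun x hx => by simp [hP.fe_dirichlet W hx])
    ((contDiff_polyFun p).mul (contDiff_polyFun q)) (fun x hx => ?_)).trans ?_
  · rw [Pi.mul_apply, Pi.mul_apply, hfp hx, hWq hx]
  set w := l2Norm (cell s) (iteratedFDeriv ℝ m (polyFun q))
  calc c.Cint * h ^ (m + 1) * l2Norm (cell s) (iteratedFDeriv ℝ (m + 1) (polyFun p * polyFun q))
      ≤ |c.Cint| * h ^ (m + 1) * ((m + 1) * G * w) := by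
        gcongr
        exacts [l2Norm_nonneg _ _, le_abs_self _]
    _ = |c.Cint| * h * ((m + 1) * G) * (h ^ m * w) := by ring
    _ ≤ |c.Cint| * h * ((m + 1) * G) * (C * l2Norm (cell s) (P.fe W)) := by
        rw [hnorm]
        exact mul_le_mul_of_nonneg_left
          (hinverse q (cell s) x h hq (isCompact_cell s) hh hball hball') (by positivity)
    _ = h * (|c.Cint| * ((m + 1) * C) * (G * l2Norm (cell s) (P.fe W))) := by ring

lemma exists_jet_interp_affine_mul_error {d : ℕ} (hd : 0 < d) (m : ℕ) (c : Constants) :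
    ∃ C : ℝ, 0 ≤ C ∧ ∀ (Ω ΓD : Set (E d)) (P : Discretisation d), P.Admissible Ω ΓD (m + 1) c →
      ∀ s ∈ P.elements, ∀ f G, IsAffineWeight Ω s f G → ∀ W : Fin P.n → ℝ,
      l2Norm (cell s) (jet P.k (f * P.fe W - P.interp (f * P.fe W)))
        ≤ C * (G * l2Norm (cell s) (P.fe W)) := by
  obtain ⟨C, hC, herror⟩ := exists_interp_affine_mul_error hd m c
  refine ⟨(1 + |c.Ch|) * C, by positivity, fun Ω ΓD P hP s hs f G hf W => ?_⟩
  set e := f * P.fe W - P.interp (f * P.fe W)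
  set h := Metric.diam (cell s)
  have hh : 0 < h := diam_cell_pos hd hs
  have hk := hP.k_pos
  have hkh : P.k * h ≤ |c.Ch| :=
    (mul_le_mul_of_nonneg_left (hP.diam_cell_le_h hs) hk.le).trans (hP.kh_le.trans (le_abs_self _))
  have hjet : l2Norm (cell s) (jet P.k e)
      ≤ l2Norm (cell s) (gradient e) + P.k * l2Norm (cell s) e :=
    (hP.isPolyOn_interp_error hs hf.isPolyOn W).l2Norm_jet_le (isCompact_cell s) (convex_cell s)
      hk.le
  have he_nonneg := l2Norm_nonneg (cell s) e
  have hgrad_nonneg := l2Norm_nonneg (cell s) (gradient e)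
  refine hjet.trans (le_of_mul_le_mul_left ?_ hh)
  calc h * (l2Norm (cell s) (gradient e) + P.k * l2Norm (cell s) e)
      ≤ (1 + P.k * h) * (l2Norm (cell s) e + h * l2Norm (cell s) (gradient e)) := by
        have : 0 ≤ P.k * h * (h * l2Norm (cell s) (gradient e)) := by positivity
        linarith
    _ ≤ (1 + |c.Ch|) * (h * (C * (G * l2Norm (cell s) (P.fe W)))) :=
        mul_le_mul (by gcongr) (herror Ω ΓD P hP s hs f G hf W) (by positivity) (by positivity)
    _ = h * ((1 + |c.Ch|) * C * (G * l2Norm (cell s) (P.fe W))) := by ring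

/-- Superapproximation: the smallness comes from the quotient `G / k` and not from the mesh size,
because `|f w|_{H^r}` involves only one derivative of `f`, and the others are traded for powers of
the mesh size by the inverse inequality. -/
lemma exists_superapproximation {d : ℕ} (hd : 0 < d) {r : ℕ} (hr : 1 ≤ r) (c : Constants) :
    ∃ C : ℝ, 0 < C ∧ ∀ (Ω ΓD : Set (E d)) (P : Discretisation d), P.Admissible Ω ΓD r c →
      ∀ s ∈ P.elements, ∀ f G, IsAffineWeight Ω s f G → ∀ W : Fin P.n → ℝ,
      l2Norm (cell s) (fun x => jet P.k (P.fe (f ∘ P.node * W)) x - f x • jet P.k (P.fe W) x)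
        ≤ C * (G / P.k) * l2Norm (cell s) (jet P.k (P.fe W)) := by
  obtain ⟨m, rfl⟩ := Nat.exists_eq_add_one_of_ne_zero (Nat.one_le_iff_ne_zero.1 hr)
  obtain ⟨C, hC, herror⟩ := exists_jet_interp_affine_mul_error hd m c
  refine ⟨1 + C, by positivity, fun Ω ΓD P hP s hs f G hf W => ?_⟩
  set e := f * P.fe W - P.interp (f * P.fe W)
  have hk := hP.k_pos
  have hG := hf.nonneg
  have hpointwise : ∀ᵐ x ∂volume.restrict (cell s),
      ‖jet P.k (P.fe (f ∘ P.node * W)) x - f x • jet P.k (P.fe W) x‖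
        ≤ ‖(G • P.fe W) x‖ + ‖jet P.k e x‖ := by
    filter_upwards [ae_mem_interior (convex_cell s)] with x hx
    rw [hP.jet_fe_mul_sub hs hf.isPolyOn W hx]
    refine (norm_sub_le _ _).trans (add_le_add_left ?_ _)
    rw [WithLp.norm_toLp_fst, norm_smul, Pi.smul_apply, norm_smul, Real.norm_of_nonneg hG, mul_comm]
    exact mul_le_mul_of_nonneg_right (hf.norm_gradient_le x hx) (norm_nonneg _)
  have hw := (hP.isPolyOn_fe hs W).memLp (isCompact_cell s)
  have hGw : l2Norm (cell s) (G • P.fe W) ≤ G * l2Norm (cell s) (P.fe W) :=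
    l2Norm_le_mul_of_norm_le hG hw
      (.of_forall fun x => by rw [Pi.smul_apply, norm_smul, Real.norm_of_nonneg hG])
  have hkw : l2Norm (cell s) (P.fe W) ≤ P.k⁻¹ * l2Norm (cell s) (jet P.k (P.fe W)) := by
    refine l2Norm_le_mul_of_norm_le (by positivity) (hP.memLp_jet_fe_cell hs P.k W)
      (.of_forall fun x => ?_)
    have hjet := norm_smul_le_norm_jet P.k (P.fe W) x
    rwa [norm_smul, Real.norm_of_nonneg hk.le, ← le_inv_mul_iff₀ hk] at hjet
  calc l2Norm (cell s) (fun x => jet P.k (P.fe (f ∘ P.node * W)) x - f x • jet P.k (P.fe W) x)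
      ≤ l2Norm (cell s) (G • P.fe W) + l2Norm (cell s) (jet P.k e) :=
        l2Norm_le_add_of_norm_le (hw.const_smul G)
          ((hP.isPolyOn_interp_error hs hf.isPolyOn W).memLp_jet (isCompact_cell s)
            (convex_cell s) P.k) hpointwise
    _ ≤ G * l2Norm (cell s) (P.fe W) + C * (G * l2Norm (cell s) (P.fe W)) :=
        add_le_add hGw (herror Ω ΓD P hP s hs f G hf W)
    _ = (1 + C) * G * l2Norm (cell s) (P.fe W) := by ring
    _ ≤ (1 + C) * G * (P.k⁻¹ * l2Norm (cell s) (jet P.k (P.fe W))) := by gcongr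
    _ = (1 + C) * (G / P.k) * l2Norm (cell s) (jet P.k (P.fe W)) := by ring

/-! ### Integration over unions of elements -/

/-- The elements contained in the closure of `U`. -/
def elementsIn (P : Discretisation d) (U : Set (E d)) : Set (Finset (E d)) :=
  {s ∈ P.elements | cell s ⊆ closure U}

/-- The regular open sets whose closure is a union of elements: the domain and the subdomains. -/
structure IsMeshed (P : Discretisation d) (U : Set (E d)) : Prop where
  interior_closure : interior (closure U) = U
  closure_eq : closure U = ⋃ s ∈ P.elementsIn U, cell s

lemma IsMeshed.isOpen (hU : P.IsMeshed U) : IsOpen U := hU.interior_closure ▸ isOpen_interior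

lemma volume_cell_inter_cell (hs : s ∈ P.elements) (ht : t ∈ P.elements) (hst : s ≠ t) :
    volume (cell s ∩ cell t) = 0 := by
  classical
  have hspan : cell s ∩ cell t ⊆ affineSpan ℝ ((s ∩ t : Finset (E d)) : Set (E d)) := by
    refine (P.mesh.inter_subset_convexHull hs.1 ht.1).trans ?_
    rw [← Finset.coe_inter]
    exact convexHull_subset_affineSpan _
  refine measure_mono_null hspan (Measure.addHaar_affineSubspace _ _ fun htop => hst ?_)
  have hind : AffineIndependent ℝ ((↑) : ((s ∩ t : Finset (E d)) : Set (E d)) → E d) :=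
    (P.mesh.indep hs.1).mono (mod_cast Finset.inter_subset_left)
  have hcard : (s ∩ t).card = s.card := by
    have h := (hind.affineSpan_eq_top_iff_card_eq_finrank_add_one).1
      (Subtype.range_coe.symm ▸ htop)
    simpa [← hs.2] using h
  have hsub : s ⊆ t := Finset.inter_eq_left.1
    (Finset.eq_of_subset_of_card_le Finset.inter_subset_left hcard.ge)
  exact Finset.eq_of_subset_of_card_le hsub (hs.2 ▸ ht.2.le)

namespace Admissible

lemma finite_elementsIn (hP : P.Admissible Ω ΓD r c) (U : Set (E d)) : Finite (P.elementsIn U) :=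
  (hP.finite_elements.subset fun _ hs => hs.1).to_subtype

lemma isMeshed_domain (hP : P.Admissible Ω ΓD r c) (hΩ : interior (closure Ω) = Ω) :
    P.IsMeshed Ω := by
  refine ⟨hΩ, (Set.iUnion₂_subset fun s hs => hs.2).antisymm' fun x hx => ?_⟩
  rw [← hP.space_eq, Geometry.SimplicialComplex.mem_space_iff] at hx
  obtain ⟨f, hf, hxf⟩ := hx
  obtain ⟨s, hs, hfs⟩ := hP.pure f hf
  exact Set.mem_biUnion ⟨hs, hP.cell_subset hs⟩ (convexHull_mono hfs hxf)

lemma isMeshed_sub (hP : P.Admissible Ω ΓD r c) (ℓ : Fin P.N) : P.IsMeshed (P.sub ℓ) := by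
  refine ⟨hP.sub_regular ℓ, (Set.iUnion₂_subset fun s hs => hs.2).antisymm' ?_⟩
  obtain ⟨T, hT, hclosure⟩ := hP.sub_elements ℓ
  intro x hx
  obtain ⟨s, hs, hxs⟩ := Set.mem_iUnion₂.1 (hclosure ▸ hx)
  exact Set.mem_biUnion ⟨hT hs, hclosure ▸ Set.subset_biUnion_of_mem (u := cell) hs⟩ hxs

lemma restrict_closure_eq_sum (hP : P.Admissible Ω ΓD r c) (hU : P.IsMeshed U) :
    volume.restrict (closure U)
      = Measure.sum fun s : P.elementsIn U => volume.restrict (cell s.1) := by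
  have := hP.finite_elementsIn U
  rw [hU.closure_eq, Set.biUnion_eq_iUnion]
  exact Measure.restrict_iUnion_ae
    (fun s t hst => volume_cell_inter_cell s.2.1 t.2.1 (Subtype.coe_injective.ne hst))
    fun s => (measurableSet_cell s.1).nullMeasurableSet

lemma ae_eq_closure (hP : P.Admissible Ω ΓD r c) (hU : P.IsMeshed U) :
    U =ᵐ[volume] closure U := by
  have := hP.finite_elementsIn U
  refine subset_closure.eventuallyLE.antisymm
    ((ae_restrict_iff' isClosed_closure.measurableSet).1 ?_)
  rw [hP.restrict_closure_eq_sum hU]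
  refine Measure.ae_sum_iff.2 fun s => (ae_mem_interior (convex_cell s.1)).mono fun x hx => ?_
  exact hU.interior_closure ▸ interior_mono s.2.2 hx

lemma restrict_eq_sum (hP : P.Admissible Ω ΓD r c) (hU : P.IsMeshed U) :
    volume.restrict U = Measure.sum fun s : P.elementsIn U => volume.restrict (cell s.1) := by
  rw [Measure.restrict_congr_set (hP.ae_eq_closure hU), hP.restrict_closure_eq_sum hU]

lemma ae_restrict_iff_cell (hP : P.Admissible Ω ΓD r c) (hU : P.IsMeshed U) {p : E d → Prop} :
    (∀ᵐ x ∂volume.restrict U, p x)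
      ↔ ∀ s ∈ P.elementsIn U, ∀ᵐ x ∂volume.restrict (cell s), p x := by
  have := hP.finite_elementsIn U
  rw [hP.restrict_eq_sum hU, Measure.ae_sum_iff, Subtype.forall]

lemma memLp_of_cell {F : Type*} [NormedAddCommGroup F] (hP : P.Admissible Ω ΓD r c)
    (hU : P.IsMeshed U) {f : E d → F}
    (hf : ∀ s ∈ P.elementsIn U, MemLp f 2 (volume.restrict (cell s))) :
    MemLp f 2 (volume.restrict U) := by
  have := hP.finite_elementsIn U
  have hmeas : AEStronglyMeasurable f (volume.restrict U) := by
    rw [hP.restrict_eq_sum hU]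
    exact aestronglyMeasurable_sum_measure_iff.2 fun s => (hf s.1 s.2).1
  rw [memLp_two_iff_integrable_sq_norm hmeas, hP.restrict_eq_sum hU]
  exact integrable_sum_measure
    (fun s => (memLp_two_iff_integrable_sq_norm (hf s.1 s.2).1).1 (hf s.1 s.2)) .of_finite

lemma hasSum_sq_l2Norm_cell {F : Type*} [NormedAddCommGroup F] (hP : P.Admissible Ω ΓD r c)
    (hU : P.IsMeshed U) {f : E d → F} (hf : MemLp f 2 (volume.restrict U)) :
    HasSum (fun s : P.elementsIn U => l2Norm (cell s.1) f ^ 2) (l2Norm U f ^ 2) := by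
  have := hP.finite_elementsIn U
  have hint := (memLp_two_iff_integrable_sq_norm hf.1).1 hf
  simp only [sq_l2Norm]
  rw [hP.restrict_eq_sum hU] at hint ⊢
  exact hasSum_integral_measure hint

lemma l2Norm_le_of_cell {F G : Type*} [NormedAddCommGroup F] [NormedAddCommGroup G]
    (hP : P.Admissible Ω ΓD r c) (hU : P.IsMeshed U) {f : E d → F} {g : E d → G} {a : ℝ}
    (ha : 0 ≤ a) (hf : MemLp f 2 (volume.restrict U)) (hg : MemLp g 2 (volume.restrict U))
    (h : ∀ s ∈ P.elementsIn U, l2Norm (cell s) f ≤ a * l2Norm (cell s) g) :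
    l2Norm U f ≤ a * l2Norm U g := by
  refine le_of_sq_le_sq ?_ (mul_nonneg ha (l2Norm_nonneg _ _))
  rw [mul_pow]
  refine hasSum_le (fun s => ?_) (hP.hasSum_sq_l2Norm_cell hU hf)
    ((hP.hasSum_sq_l2Norm_cell hU hg).mul_left _)
  rw [← mul_pow]
  exact pow_le_pow_left₀ (l2Norm_nonneg _ _) (h s.1 s.2) 2

/-! ### Locality of the nodal basis and of the partition of unity -/

lemma eqOn_cell_of_ae_eq (hP : P.Admissible Ω ΓD r c) (hd : 0 < d) (hs : s ∈ P.elements)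
    {f g : E d → ℝ} (hf : ContinuousOn f (closure Ω)) (hg : ContinuousOn g (closure Ω))
    (h : f =ᵐ[volume.restrict (cell s)] g) : Set.EqOn f g (cell s) :=
  Measure.eqOn_of_ae_eq h (hf.mono (hP.cell_subset hs)) (hg.mono (hP.cell_subset hs))
    (hP.closure_interior_cell hd hs).ge

lemma isClosed_dirichlet (hP : P.Admissible Ω ΓD r c) : IsClosed ΓD := by
  obtain ⟨F, hF, rfl⟩ := hP.dirichlet
  exact (hP.finite_mesh.subset fun s hs => (hF hs).1).isClosed_biUnion
    fun s _ => (isCompact_cell s).isClosed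

lemma node_injective (hP : P.Admissible Ω ΓD r c) : Function.Injective P.node := fun p q h => by
  have hpq := hP.φ_node p q
  rw [← h, hP.φ_node p p, if_pos rfl] at hpq
  by_contra hne
  exact one_ne_zero (hpq.trans (if_neg hne))

lemma exists_continuous_bump (hP : P.Admissible Ω ΓD r c) {q : Fin P.n}
    (hq : P.node q ∉ cell s) : ∃ v : E d → ℝ, Continuous v ∧ (∀ x ∈ cell s, v x = 0) ∧
      (∀ x ∈ ΓD, v x = 0) ∧ v ∘ P.node = Pi.single q 1 := by
  have hqΓ : P.node q ∉ ΓD := fun h => by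
    simpa [hP.φ_node] using (hP.φ_fe q).2.2 _ h
  have hclosed : IsClosed (cell s ∪ ΓD ∪ P.node '' {q}ᶜ) :=
    ((isCompact_cell s).isClosed.union hP.isClosed_dirichlet).union
      (Set.toFinite _).isClosed
  have hmem : P.node q ∉ cell s ∪ ΓD ∪ P.node '' {q}ᶜ := by
    simp [hq, hqΓ, hP.node_injective.eq_iff]
  obtain ⟨v, hzero, hone, -⟩ := exists_continuous_zero_one_of_isClosed hclosed isClosed_singleton
    (Set.disjoint_singleton_right.2 hmem)
  refine ⟨v, v.continuous, fun x hx => hzero (.inl (.inl hx)), fun x hx => hzero (.inl (.inr hx)),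
    funext fun p => ?_⟩
  rcases eq_or_ne p q with rfl | hp
  · rw [Function.comp_apply, Pi.single_eq_same]
    exact hone rfl
  · rw [Function.comp_apply, Pi.single_eq_of_ne hp]
    exact hzero (.inr ⟨p, hp, rfl⟩)

/-- The interpolation estimate is local, so it kills the basis functions whose nodes lie outside
the element: interpolate a function which vanishes there. -/
lemma φ_eq_zero (hP : P.Admissible Ω ΓD r c) (hd : 0 < d) (hs : s ∈ P.elements) {q : Fin P.n}
    (hq : P.node q ∉ cell s) : Set.EqOn (P.φ q) 0 (cell s) := by
  obtain ⟨v, hv, hvs, hvΓ, hvnode⟩ := hP.exists_continuous_bump hq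
  have herror := hP.interp_error s hs v 0 hv.continuousOn hvΓ contDiff_zero_fun hvs
  rw [interp_eq_fe, hvnode, fe_single] at herror
  have hright : l2Norm (cell s) (iteratedFDeriv ℝ r (0 : E d → ℝ)) = 0 := by
    simp [l2Norm]
  have hleft : l2Norm (cell s) (v - P.φ q) = l2Norm (cell s) (P.φ q) := by
    rw [← l2Norm_norm _ (v - _), ← l2Norm_norm _ (P.φ q)]
    exact l2Norm_congr (ae_restrict_of_forall_mem (measurableSet_cell s)
      fun x hx => by simp [hvs x hx])
  rw [hright, mul_zero, hleft] at herror
  refine hP.eqOn_cell_of_ae_eq hd hs (hP.φ_fe q).1 continuousOn_const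
    (ae_eq_zero_of_l2Norm_eq_zero (((hP.φ_fe q).2.1 s hs).memLp (isCompact_cell s))
      (((le_add_of_nonneg_right ?_).trans herror).antisymm (l2Norm_nonneg _ _)))
  exact mul_nonneg Metric.diam_nonneg (l2Norm_nonneg _ _)

lemma fe_eqOn_cell (hP : P.Admissible Ω ΓD r c) (hd : 0 < d) (hs : s ∈ P.elements)
    {V W : Fin P.n → ℝ} (h : ∀ p, P.node p ∈ cell s → V p = W p) :
    Set.EqOn (P.fe V) (P.fe W) (cell s) := fun x hx => by
  rw [fe_apply, fe_apply]
  refine Finset.sum_congr rfl fun p _ => ?_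
  by_cases hp : P.node p ∈ cell s
  · rw [h p hp]
  · rw [hP.φ_eq_zero hd hs hp hx, Pi.zero_apply, mul_zero, mul_zero]

lemma jet_fe_congr_cell (hP : P.Admissible Ω ΓD r c) (hd : 0 < d) (hs : s ∈ P.elements)
    {V W : Fin P.n → ℝ} (h : ∀ p, P.node p ∈ cell s → V p = W p) (k : ℝ) :
    jet k (P.fe V) =ᵐ[volume.restrict (cell s)] jet k (P.fe W) :=
  (ae_mem_interior (convex_cell s)).mono fun _ hx => jet_congr k
    ((hP.fe_eqOn_cell hd hs h).eventuallyEq_of_mem (mem_interior_iff_mem_nhds.1 hx))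

lemma fe_injective (hP : P.Admissible Ω ΓD r c) (hd : 0 < d) (hΩ : P.IsMeshed Ω)
    {V W : Fin P.n → ℝ} (h : P.fe V =ᵐ[volume.restrict Ω] P.fe W) : V = W := by
  funext q
  obtain ⟨s, hs, hqs⟩ := Set.mem_iUnion₂.1 (hΩ.closure_eq ▸ hP.node_mem q)
  have hcell := hP.eqOn_cell_of_ae_eq hd hs.1 (hP.continuousOn_fe V) (hP.continuousOn_fe W)
    ((hP.ae_restrict_iff_cell hΩ).1 h s hs)
  rw [← hP.fe_node V, ← hP.fe_node W, hcell hqs]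

lemma χ_eq_zero (hP : P.Admissible Ω ΓD r c) (hd : 0 < d) (hs : s ∈ P.elements)
    (hsℓ : ¬cell s ⊆ closure (P.sub ℓ)) : Set.EqOn (P.χ ℓ) 0 (cell s) := by
  obtain ⟨T, hT, hclosure⟩ := hP.sub_elements ℓ
  have hnull : volume (⋃ t ∈ T, cell s ∩ cell t) = 0 := by
    refine (measure_biUnion_null_iff (hP.finite_elements.subset hT).countable).2 fun t ht => ?_
    refine volume_cell_inter_cell hs (hT ht) ?_
    rintro rfl
    exact hsℓ (hclosure ▸ Set.subset_biUnion_of_mem (u := cell) ht)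
  refine hP.eqOn_cell_of_ae_eq hd hs (hP.χ_cont ℓ) continuousOn_const ?_
  filter_upwards [ae_restrict_mem (measurableSet_cell s),
    ae_restrict_of_ae (measure_eq_zero_iff_ae_notMem.1 hnull)] with x hx hxT
  by_contra hne
  obtain ⟨t, ht, hxt⟩ :=
    Set.mem_iUnion₂.1 (hclosure ▸ hP.χ_supp ℓ x (hP.cell_subset hs hx) hne)
  exact hxT (Set.mem_biUnion ht ⟨hx, hxt⟩)

end Admissible

/-! ### The overlap and the partition of unity -/

open Classical in
lemma card_mem_closure_sub_le_Λ (P : Discretisation d) (x : E d) :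
    (Finset.univ.filter fun ℓ => x ∈ closure (P.sub ℓ)).card ≤ P.Λ := by
  rcases (Finset.univ.filter fun ℓ => x ∈ closure (P.sub ℓ)).eq_empty_or_nonempty with
    hempty | ⟨ℓ, hℓ⟩
  · rw [hempty, Finset.card_empty]
    exact Nat.zero_le _
  · have hΛ : (Finset.univ.filter fun ℓ' =>
        (closure (P.sub ℓ) ∩ closure (P.sub ℓ')).Nonempty).card ≤ P.Λ :=
      Finset.le_sup (f := fun ℓ => (Finset.univ.filter fun ℓ' =>
        (closure (P.sub ℓ) ∩ closure (P.sub ℓ')).Nonempty).card) (Finset.mem_univ ℓ)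
    exact (Finset.card_le_card (Finset.monotone_filter_right _ fun ℓ' _ hℓ' =>
      ⟨x, (Finset.mem_filter.1 hℓ).2, hℓ'⟩)).trans hΛ

namespace Admissible

lemma sub_subset (hP : P.Admissible Ω ΓD r c) (ℓ : Fin P.N) : P.sub ℓ ⊆ Ω :=
  hP.cover ▸ Set.subset_iUnion P.sub ℓ

lemma one_le_Λ_mul_sum_sq_χ (hP : P.Admissible Ω ΓD r c) (hx : x ∈ closure Ω) :
    1 ≤ P.Λ * ∑ ℓ, P.χ ℓ x ^ 2 := by
  classical
  set T := Finset.univ.filter fun ℓ => x ∈ closure (P.sub ℓ)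
  have hone : ∑ ℓ ∈ T, P.χ ℓ x = 1 := by
    rw [Finset.sum_filter_of_ne fun ℓ _ => hP.χ_supp ℓ x hx, hP.χ_sum x hx]
  calc (1 : ℝ) = (∑ ℓ ∈ T, P.χ ℓ x) ^ 2 := by rw [hone, one_pow]
    _ ≤ T.card * ∑ ℓ ∈ T, P.χ ℓ x ^ 2 := sq_sum_le_card_mul_sum_sq
    _ ≤ P.Λ * ∑ ℓ, P.χ ℓ x ^ 2 := mul_le_mul (mod_cast P.card_mem_closure_sub_le_Λ x)
        (Finset.sum_le_univ_sum_of_nonneg fun ℓ => sq_nonneg _)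
        (Finset.sum_nonneg fun ℓ _ => sq_nonneg _) (Nat.cast_nonneg _)

lemma Λ_pos (hP : P.Admissible Ω ΓD r c) (hΩ : Ω.Nonempty) : (0 : ℝ) < P.Λ := by
  obtain ⟨x, hx⟩ := hΩ
  refine (Nat.cast_nonneg _).lt_of_ne fun h => ?_
  have hone := hP.one_le_Λ_mul_sum_sq_χ (subset_closure hx)
  rw [← h, zero_mul] at hone
  exact one_pos.not_ge hone

lemma sum_setIntegral_sub_le (hP : P.Admissible Ω ΓD r c) {f : E d → ℝ} (hf : ∀ x, 0 ≤ f x)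
    (hint : IntegrableOn f Ω) : ∑ ℓ, ∫ x in P.sub ℓ, f x ≤ P.Λ * ∫ x in Ω, f x := by
  classical
  have hindicator : ∀ ℓ, ∫ x in P.sub ℓ, f x = ∫ x in Ω, (P.sub ℓ).indicator f x := fun ℓ => by
    rw [setIntegral_indicator (hP.sub_open ℓ).measurableSet,
      Set.inter_eq_self_of_subset_right (hP.sub_subset ℓ)]
  have hint_sub : ∀ ℓ, IntegrableOn ((P.sub ℓ).indicator f) Ω := fun ℓ =>
    hint.indicator (hP.sub_open ℓ).measurableSet
  simp only [hindicator]
  rw [← integral_finsetSum _ fun ℓ _ => hint_sub ℓ, ← integral_const_mul]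
  refine integral_mono (integrable_finsetSum _ fun ℓ _ => hint_sub ℓ) (hint.const_mul _)
    fun x => ?_
  calc ∑ ℓ, (P.sub ℓ).indicator f x
      ≤ ∑ ℓ, if x ∈ closure (P.sub ℓ) then f x else 0 := Finset.sum_le_sum fun ℓ _ =>
        Set.indicator_le_indicator_of_subset subset_closure hf x
    _ = (Finset.univ.filter fun ℓ => x ∈ closure (P.sub ℓ)).card * f x := by
        rw [← Finset.sum_filter, Finset.sum_const, nsmul_eq_mul]
    _ ≤ P.Λ * f x :=
        mul_le_mul_of_nonneg_right (mod_cast P.card_mem_closure_sub_le_Λ x) (hf x)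

lemma setIntegral_sub_eq (hP : P.Admissible Ω ΓD r c) (hΩ : P.IsMeshed Ω) (ℓ : Fin P.N)
    {f : E d → ℝ} (hf : ∀ s ∈ P.elements, ¬cell s ⊆ closure (P.sub ℓ) →
      ∀ᵐ x ∂volume.restrict (cell s), f x = 0) :
    ∫ x in P.sub ℓ, f x = ∫ x in Ω, f x := by
  refine (setIntegral_eq_of_subset_of_ae_sdiff_eq_zero hΩ.isOpen.nullMeasurableSet
    (hP.sub_subset ℓ) ?_).symm
  have hcell : ∀ᵐ x ∂volume.restrict Ω, x ∉ P.sub ℓ → f x = 0 :=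
    (hP.ae_restrict_iff_cell hΩ).2 fun s hs => by
      by_cases hsℓ : cell s ⊆ closure (P.sub ℓ)
      · filter_upwards [ae_mem_interior (convex_cell s)] with x hx hxℓ
        exact absurd (hP.sub_regular ℓ ▸ interior_mono hsℓ hx) hxℓ
      · exact (hf s hs.1 hsℓ).mono fun x hx _ => hx
  filter_upwards [(ae_restrict_iff' hΩ.isOpen.measurableSet).1 hcell] with x hx hxΩ
  exact hx hxΩ.1 hxΩ.2

lemma setIntegral_le_Λ_mul_sum (hP : P.Admissible Ω ΓD r c) (hd : 0 < d) (hΩ : P.IsMeshed Ω)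
    {f : E d → ℝ} (hf : ∀ x, 0 ≤ f x) (hint : IntegrableOn f Ω) :
    ∫ x in Ω, f x ≤ P.Λ * ∑ ℓ, ∫ x in P.sub ℓ, P.χ ℓ x ^ 2 * f x := by
  have hsub : ∀ ℓ, ∫ x in P.sub ℓ, P.χ ℓ x ^ 2 * f x = ∫ x in Ω, P.χ ℓ x ^ 2 * f x := fun ℓ =>
    hP.setIntegral_sub_eq hΩ ℓ fun s hs hsℓ =>
      ae_restrict_of_forall_mem (measurableSet_cell s) fun x hx => by
        simp [hP.χ_eq_zero hd hs hsℓ hx]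
  have hint_χ : ∀ ℓ, IntegrableOn (fun x => P.χ ℓ x ^ 2 * f x) Ω := fun ℓ => by
    refine hint.bdd_mul (c := 1) ((((hP.χ_cont ℓ).mono subset_closure).pow
      2).aestronglyMeasurable hΩ.isOpen.measurableSet) ?_
    refine ae_restrict_of_forall_mem hΩ.isOpen.measurableSet fun x hx => ?_
    have hχ := hP.χ_mem ℓ x (subset_closure hx)
    rw [norm_pow, Real.norm_of_nonneg hχ.1]
    exact pow_le_one₀ hχ.1 hχ.2
  simp only [hsub]
  rw [← integral_finsetSum _ fun ℓ _ => hint_χ ℓ, ← integral_const_mul]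
  refine setIntegral_mono_on hint ((integrable_finsetSum _ fun ℓ _ => hint_χ ℓ).const_mul _)
    hΩ.isOpen.measurableSet fun x hx => ?_
  rw [← Finset.sum_mul, ← mul_assoc]
  exact le_mul_of_one_le_left (hf x) (hP.one_le_Λ_mul_sum_sq_χ (subset_closure hx))

lemma k_mul_δ_pos (hP : P.Admissible Ω ΓD r c) : 0 < P.k * P.δ := c.cδ_pos.trans_le hP.kδ_ge

lemma δ_pos (hP : P.Admissible Ω ΓD r c) : 0 < P.δ :=
  pos_of_mul_pos_right hP.k_mul_δ_pos hP.k_pos.le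

lemma isAffineWeight_χ (hP : P.Admissible Ω ΓD r c) (hs : s ∈ P.elements) (ℓ : Fin P.N) :
    IsAffineWeight Ω s (P.χ ℓ) (|c.Cχ| / P.δ) where
  continuousOn := hP.χ_cont ℓ
  isPolyOn := hP.χ_linear ℓ s hs
  nonneg := div_nonneg (abs_nonneg _) hP.δ_pos.le
  norm_gradient_le x hx := (hP.χ_grad ℓ s hs x hx).trans
    (div_le_div₀ (abs_nonneg _) (le_abs_self _) hP.δ_pos
      (ciInf_le (Set.finite_range P.δℓ).bddBelow ℓ))

/-! ### The energy form as an inner product -/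

lemma memLp_jet_fe (hP : P.Admissible Ω ΓD r c) (hU : P.IsMeshed U) (W : Fin P.n → ℝ) :
    MemLp (jet P.k (P.fe W)) 2 (volume.restrict U) :=
  hP.memLp_of_cell hU fun _ hs => hP.memLp_jet_fe_cell hs.1 P.k W

/-- The map from nodal values to the jets of finite-element functions on `U`, as square-integrable
functions: the energy inner product is the pullback of the `L²` inner product. -/
def energyMap (hP : P.Admissible Ω ΓD r c) (hU : P.IsMeshed U) :
    (Fin P.n → ℝ) →ₗ[ℝ] Lp (WithLp 2 (E d × ℝ)) 2 (volume.restrict U) where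
  toFun W := (hP.memLp_jet_fe hU W).toLp
  map_add' V W := by
    rw [← MemLp.toLp_add, MemLp.toLp_eq_toLp_iff]
    refine (hP.ae_restrict_iff_cell hU).2 fun s hs =>
      (ae_mem_interior (convex_cell s)).mono fun x hx => ?_
    rw [map_add]
    exact jet_add P.k ((hP.isPolyOn_fe hs.1 V).differentiableAt hx)
      ((hP.isPolyOn_fe hs.1 W).differentiableAt hx)
  map_smul' a W := by
    rw [RingHom.id_apply, ← MemLp.toLp_const_smul, MemLp.toLp_eq_toLp_iff]
    refine (hP.ae_restrict_iff_cell hU).2 fun s hs =>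
      (ae_mem_interior (convex_cell s)).mono fun x hx => ?_
    rw [map_smul]
    exact jet_const_smul P.k a ((hP.isPolyOn_fe hs.1 W).differentiableAt hx)

lemma coeFn_energyMap (hP : P.Admissible Ω ΓD r c) (hU : P.IsMeshed U) (W : Fin P.n → ℝ) :
    hP.energyMap hU W =ᵐ[volume.restrict U] jet P.k (P.fe W) :=
  (hP.memLp_jet_fe hU W).coeFn_toLp

lemma inner_energyMap (hP : P.Admissible Ω ΓD r c) (hU : P.IsMeshed U) (V W : Fin P.n → ℝ) :
    inner ℝ (hP.energyMap hU V) (hP.energyMap hU W)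
      = ∫ x in U, inner ℝ (jet P.k (P.fe V) x) (jet P.k (P.fe W) x) := by
  rw [L2.inner_def]
  refine integral_congr_ae ?_
  filter_upwards [hP.coeFn_energyMap hU V, hP.coeFn_energyMap hU W] with x hV hW
  rw [hV, hW]

lemma norm_energyMap (hP : P.Admissible Ω ΓD r c) (hU : P.IsMeshed U) (W : Fin P.n → ℝ) :
    ‖hP.energyMap hU W‖ = l2Norm U (jet P.k (P.fe W)) :=
  norm_eq_l2Norm_of_ae_eq (hP.coeFn_energyMap hU W)

lemma energyMap_congr (hP : P.Admissible Ω ΓD r c) (hd : 0 < d) (hU : P.IsMeshed U)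
    {V W : Fin P.n → ℝ} (h : ∀ p, P.node p ∈ closure U → V p = W p) :
    hP.energyMap hU V = hP.energyMap hU W :=
  (MemLp.toLp_eq_toLp_iff (hP.memLp_jet_fe hU V) (hP.memLp_jet_fe hU W)).2 <|
    (hP.ae_restrict_iff_cell hU).2 fun _ hs =>
      hP.jet_fe_congr_cell hd hs.1 (fun p hp => h p (hs.2 hp)) P.k

lemma energyMap_injective (hP : P.Admissible Ω ΓD r c) (hd : 0 < d) (hΩ : P.IsMeshed Ω) :
    Function.Injective (hP.energyMap hΩ) := by
  refine (injective_iff_map_eq_zero _).2 fun W hW => hP.fe_injective hd hΩ ?_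
  rw [map_zero]
  filter_upwards [hP.coeFn_energyMap hΩ W, Lp.eq_zero_iff_ae_eq_zero.1 hW] with x hx hzero
  have hjet : jet P.k (P.fe W) x = 0 := hx.symm.trans hzero
  have hnorm := norm_smul_le_norm_jet P.k (P.fe W) x
  rw [hjet, norm_zero, norm_le_zero_iff, smul_eq_zero] at hnorm
  exact hnorm.resolve_left hP.k_pos.ne'

lemma integrable_φ_mul_φ (hP : P.Admissible Ω ΓD r c) (hU : P.IsMeshed U) (p q : Fin P.n) :
    IntegrableOn (fun x => P.φ p x * P.φ q x) U := by
  have hφ : ∀ p, MemLp (P.φ p) 2 (volume.restrict U) := fun p =>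
    hP.memLp_of_cell hU fun s hs => ((hP.φ_fe p).2.1 s hs.1).memLp (isCompact_cell s)
  exact (hφ p).integrable_mul (hφ q)

lemma integrable_inner_gradient_φ (hP : P.Admissible Ω ΓD r c) (hU : P.IsMeshed U)
    (p q : Fin P.n) :
    IntegrableOn (fun x => inner ℝ (gradient (P.φ p) x) (gradient (P.φ q) x)) U := by
  have hφ : ∀ p, MemLp (gradient (P.φ p)) 2 (volume.restrict U) := fun p =>
    hP.memLp_of_cell hU fun s hs =>
      ((hP.φ_fe p).2.1 s hs.1).memLp_gradient (isCompact_cell s) (convex_cell s)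
  exact memLp_one_iff_integrable.1 ((innerSL ℝ).memLp_of_bilin 1 (hφ p) (hφ q))

lemma energy_eq_gram (hP : P.Admissible Ω ΓD r c) (hU : P.IsMeshed U) :
    P.energy U
      = (Matrix.gram ℝ fun p => hP.energyMap hU (Pi.single p 1)).map fun t => (t : ℂ) := by
  have hgram : Matrix.gram ℝ (fun p => hP.energyMap hU (Pi.single p 1))
      = P.stiffness U + P.k ^ 2 • P.mass U := by
    ext p q
    simp only [Matrix.gram_apply, hP.inner_energyMap, fe_single, inner_jet]
    rw [integral_add (hP.integrable_inner_gradient_φ hU p q)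
      ((hP.integrable_φ_mul_φ hU p q).const_mul _), integral_const_mul]
    rfl
  ext p q
  simp [hgram, energy]

/-! ### The splitting by subdomains -/

lemma memLp_top_χ (hP : P.Admissible Ω ΓD r c) (ℓ : Fin P.N) :
    MemLp (P.χ ℓ) ⊤ (volume.restrict (P.sub ℓ)) := by
  have hmeas := (hP.sub_open ℓ).measurableSet
  have hsub : P.sub ℓ ⊆ closure Ω := (hP.sub_subset ℓ).trans subset_closure
  refine memLp_top_of_bound (((hP.χ_cont ℓ).mono hsub).aestronglyMeasurable hmeas) 1
    (ae_restrict_of_forall_mem hmeas fun x hx => ?_)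
  rw [Real.norm_of_nonneg (hP.χ_mem ℓ x (hsub hx)).1]
  exact (hP.χ_mem ℓ x (hsub hx)).2

/-- Multiplication of jets by the weight of the subdomain. -/
def weightedEnergyMap (hP : P.Admissible Ω ΓD r c) (ℓ : Fin P.N) :
    (Fin P.n → ℝ) →ₗ[ℝ] Lp (WithLp 2 (E d × ℝ)) 2 (volume.restrict (P.sub ℓ)) :=
  (ContinuousLinearMap.lsmul ℝ ℝ).holderₗ (volume.restrict (P.sub ℓ)) ⊤ 2 2 (hP.memLp_top_χ ℓ).toLp
    ∘ₗ hP.energyMap (hP.isMeshed_sub ℓ)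

lemma coeFn_weightedEnergyMap (hP : P.Admissible Ω ΓD r c) (ℓ : Fin P.N) (W : Fin P.n → ℝ) :
    hP.weightedEnergyMap ℓ W
      =ᵐ[volume.restrict (P.sub ℓ)] fun x => P.χ ℓ x • jet P.k (P.fe W) x := by
  filter_upwards [(ContinuousLinearMap.lsmul ℝ ℝ).coeFn_holder (r := 2) (hP.memLp_top_χ ℓ).toLp
    (hP.energyMap (hP.isMeshed_sub ℓ) W), (hP.memLp_top_χ ℓ).coeFn_toLp,
    hP.coeFn_energyMap (hP.isMeshed_sub ℓ) W] with x hmul hχ hW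
  rw [← hχ, ← hW]
  exact hmul

lemma sum_sq_norm_energyMap_sub_le (hP : P.Admissible Ω ΓD r c) (hΩ : P.IsMeshed Ω)
    (W : Fin P.n → ℝ) :
    ∑ ℓ, ‖hP.energyMap (hP.isMeshed_sub ℓ) W‖ ^ 2 ≤ P.Λ * ‖hP.energyMap hΩ W‖ ^ 2 := by
  simp only [norm_energyMap, sq_l2Norm]
  have hjet := hP.memLp_jet_fe hΩ W
  exact hP.sum_setIntegral_sub_le (fun x => sq_nonneg _)
    ((memLp_two_iff_integrable_sq_norm hjet.1).1 hjet)

lemma inner_energyMap_localise (hP : P.Admissible Ω ΓD r c) (hd : 0 < d) (hΩ : P.IsMeshed Ω)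
    (ℓ : Fin P.N) (V W : Fin P.n → ℝ) :
    inner ℝ (hP.energyMap hΩ V) (hP.energyMap hΩ (P.χ ℓ ∘ P.node * W))
      = inner ℝ (hP.energyMap (hP.isMeshed_sub ℓ) V)
          (hP.energyMap (hP.isMeshed_sub ℓ) (P.χ ℓ ∘ P.node * W)) := by
  rw [inner_energyMap, inner_energyMap]
  refine (hP.setIntegral_sub_eq hΩ ℓ fun s hs hsℓ => ?_).symm
  have hnode : ∀ p, P.node p ∈ cell s → (P.χ ℓ ∘ P.node * W) p = (0 : Fin P.n → ℝ) p :=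
    fun p hp => by
      rw [Pi.mul_apply, Function.comp_apply, hP.χ_eq_zero hd hs hsℓ hp, Pi.zero_apply, zero_mul,
        Pi.zero_apply]
  filter_upwards [hP.jet_fe_congr_cell hd hs hnode P.k] with x hx
  rw [hx, map_zero, jet_zero, inner_zero_right]

lemma norm_weightedEnergyMap (hP : P.Admissible Ω ΓD r c) (ℓ : Fin P.N) (W : Fin P.n → ℝ) :
    ‖hP.weightedEnergyMap ℓ W‖ = l2Norm (P.sub ℓ) fun x => P.χ ℓ x • jet P.k (P.fe W) x :=
  norm_eq_l2Norm_of_ae_eq (hP.coeFn_weightedEnergyMap ℓ W)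

lemma norm_weightedEnergyMap_le (hP : P.Admissible Ω ΓD r c) (ℓ : Fin P.N) (W : Fin P.n → ℝ) :
    ‖hP.weightedEnergyMap ℓ W‖ ≤ ‖hP.energyMap (hP.isMeshed_sub ℓ) W‖ := by
  rw [norm_weightedEnergyMap, norm_energyMap, ← one_mul (l2Norm _ (jet _ _))]
  refine l2Norm_le_mul_of_norm_le zero_le_one (hP.memLp_jet_fe (hP.isMeshed_sub ℓ) W)
    (ae_restrict_of_forall_mem (hP.sub_open ℓ).measurableSet fun x hx => ?_)
  have hχ := hP.χ_mem ℓ x (subset_closure (hP.sub_subset ℓ hx))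
  rw [norm_smul, Real.norm_of_nonneg hχ.1]
  exact mul_le_mul_of_nonneg_right hχ.2 (norm_nonneg _)

lemma inner_weightedEnergyMap (hP : P.Admissible Ω ΓD r c) (ℓ : Fin P.N) (V W : Fin P.n → ℝ) :
    inner ℝ (hP.energyMap (hP.isMeshed_sub ℓ) V) (hP.weightedEnergyMap ℓ W)
      = inner ℝ (hP.weightedEnergyMap ℓ V) (hP.energyMap (hP.isMeshed_sub ℓ) W) := by
  rw [L2.inner_def, L2.inner_def]
  refine integral_congr_ae ?_
  filter_upwards [hP.coeFn_energyMap (hP.isMeshed_sub ℓ) V,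
    hP.coeFn_energyMap (hP.isMeshed_sub ℓ) W, hP.coeFn_weightedEnergyMap ℓ V,
    hP.coeFn_weightedEnergyMap ℓ W] with x hV hW hχV hχW
  rw [hV, hW, hχV, hχW, real_inner_smul_left, real_inner_smul_right]

lemma sq_norm_energyMap_le (hP : P.Admissible Ω ΓD r c) (hd : 0 < d) (hΩ : P.IsMeshed Ω)
    (W : Fin P.n → ℝ) :
    ‖hP.energyMap hΩ W‖ ^ 2 ≤ P.Λ * ∑ ℓ, ‖hP.weightedEnergyMap ℓ W‖ ^ 2 := by
  simp only [norm_energyMap, norm_weightedEnergyMap, sq_l2Norm, norm_smul, mul_pow,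
    Real.norm_eq_abs, sq_abs]
  have hjet := hP.memLp_jet_fe hΩ W
  exact hP.setIntegral_le_Λ_mul_sum hd hΩ (fun x => sq_nonneg _)
    ((memLp_two_iff_integrable_sq_norm hjet.1).1 hjet)

end Admissible

lemma exists_norm_energyMap_sub_weightedEnergyMap_le {d : ℕ} (hd : 0 < d) {r : ℕ} (hr : 1 ≤ r)
    (c : Constants) :
    ∃ C : ℝ, 0 ≤ C ∧ ∀ (Ω ΓD : Set (E d)) (P : Discretisation d) (hP : P.Admissible Ω ΓD r c)
      (ℓ : Fin P.N) (W : Fin P.n → ℝ),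
      ‖hP.energyMap (hP.isMeshed_sub ℓ) (P.χ ℓ ∘ P.node * W) - hP.weightedEnergyMap ℓ W‖
        ≤ C / (P.k * P.δ) * ‖hP.energyMap (hP.isMeshed_sub ℓ) W‖ := by
  obtain ⟨C, hC, hsuper⟩ := exists_superapproximation hd hr c
  refine ⟨C * |c.Cχ|, by positivity, fun Ω ΓD P hP ℓ W => ?_⟩
  set T := hP.energyMap (hP.isMeshed_sub ℓ) (P.χ ℓ ∘ P.node * W) - hP.weightedEnergyMap ℓ W
  have hT : T =ᵐ[volume.restrict (P.sub ℓ)]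
      fun x => jet P.k (P.fe (P.χ ℓ ∘ P.node * W)) x - P.χ ℓ x • jet P.k (P.fe W) x := by
    filter_upwards [Lp.coeFn_sub (hP.energyMap (hP.isMeshed_sub ℓ) (P.χ ℓ ∘ P.node * W))
      (hP.weightedEnergyMap ℓ W), hP.coeFn_energyMap (hP.isMeshed_sub ℓ) (P.χ ℓ ∘ P.node * W),
      hP.coeFn_weightedEnergyMap ℓ W] with x hsub hQ hM
    rw [hsub, Pi.sub_apply, hQ, hM]
  rw [norm_eq_l2Norm_of_ae_eq hT, hP.norm_energyMap]
  refine hP.l2Norm_le_of_cell (hP.isMeshed_sub ℓ)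
    (div_nonneg (by positivity) hP.k_mul_δ_pos.le) ((Lp.memLp T).ae_eq hT)
    (hP.memLp_jet_fe (hP.isMeshed_sub ℓ) W) fun s hs => ?_
  refine (hsuper Ω ΓD P hP s hs.1 (P.χ ℓ) _ (hP.isAffineWeight_χ hs.1 ℓ) W).trans_eq ?_
  rw [div_div, mul_comm P.δ, mul_div_assoc]

lemma exists_isSplitting {d : ℕ} (hd : 0 < d) {r : ℕ} (hr : 1 ≤ r) (c : Constants) :
    ∃ K : ℝ, 0 ≤ K ∧ ∀ (Ω ΓD : Set (E d)) (P : Discretisation d) (hP : P.Admissible Ω ΓD r c)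
      (hΩ : P.IsMeshed Ω), Ω.Nonempty →
      IsSplitting (hP.energyMap hΩ) (fun ℓ => hP.energyMap (hP.isMeshed_sub ℓ))
        (fun ℓ => LinearMap.mulLeft ℝ (P.χ ℓ ∘ P.node)) hP.weightedEnergyMap P.Λ
        (K / (P.k * P.δ)) := by
  obtain ⟨K, hK, herror⟩ := exists_norm_energyMap_sub_weightedEnergyMap_le hd hr c
  exact ⟨K, hK, fun Ω ΓD P hP hΩ hne =>
    { nonneg := div_nonneg hK hP.k_mul_δ_pos.le
      pos := hP.Λ_pos hne
      overlap := hP.sum_sq_norm_energyMap_sub_le hΩ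
      inner_localise := hP.inner_energyMap_localise hd hΩ
      norm_le := hP.norm_weightedEnergyMap_le
      symm := hP.inner_weightedEnergyMap
      norm_sub_le := herror Ω ΓD P hP
      cover := hP.sq_norm_energyMap_le hd hΩ }⟩

/-! ### The preconditioned matrix -/

lemma R_mulVec (ℓ : Fin P.N) (V : Fin P.n → ℂ) (p : P.LocalNode ℓ) :
    (P.R ℓ).mulVec V p = P.χ ℓ (P.node p) * V p := by
  simp [Matrix.mulVec, dotProduct, R]

lemma R_transpose_mulVec (ℓ : Fin P.N) (X : P.LocalNode ℓ → ℂ) :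
    (P.R ℓ).transpose.mulVec X
      = (fun p => (P.χ ℓ (P.node p) : ℂ)) * Function.extend Subtype.val X 0 := by
  ext p
  have hcolumn : (fun q => (P.R ℓ).transpose p q)
      = Pi.single p (P.χ ℓ (P.node p) : ℂ) ∘ Subtype.val := by
    ext q
    simp only [Matrix.transpose_apply, R, Function.comp_apply, Pi.single_apply]
  rw [Matrix.mulVec, hcolumn, dotProduct_comm,
    ← extend_zero_dotProduct Subtype.val_injective, dotProduct_single, mul_comm, Pi.mul_apply]

/-- The local solution error `(A_{ε,ℓ}⁻¹ R_ℓ A_ε - R_ℓ) V`, extended by zero to all nodes. -/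
def localDefect (P : Discretisation d) (Ω ΓD : Set (E d)) (ℓ : Fin P.N) (V : Fin P.n → ℂ) :
    Fin P.n → ℂ :=
  Function.extend Subtype.val (((P.Aloc ΓD ℓ)⁻¹ * P.R ℓ * P.A Ω ΓD - P.R ℓ).mulVec V) 0

namespace Admissible

lemma extend_R_mulVec (hP : P.Admissible Ω ΓD r c) (ℓ : Fin P.N) (V : Fin P.n → ℂ) :
    Function.extend Subtype.val ((P.R ℓ).mulVec V) 0 = (fun p => (P.χ ℓ (P.node p) : ℂ)) * V := by
  ext p
  by_cases hp : P.node p ∈ closure (P.sub ℓ)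
  · exact (Subtype.val_injective.extend_apply _ _ (⟨p, hp⟩ : P.LocalNode ℓ)).trans
      (P.R_mulVec ℓ V _)
  · have hχ : P.χ ℓ (P.node p) = 0 :=
      by_contra fun hne => hp (hP.χ_supp ℓ _ (hP.node_mem p) hne)
    rw [Function.extend_apply' _ _ _ fun ⟨q, hq⟩ => hp (hq ▸ q.2), Pi.mul_apply, hχ,
      Complex.ofReal_zero, zero_mul, Pi.zero_apply]

lemma Binv_mul_A_mulVec (hP : P.Admissible Ω ΓD r c) (V : Fin P.n → ℂ) :
    (P.Binv ΓD * P.A Ω ΓD).mulVec V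
      = ∑ ℓ, LinearMap.mulLeft ℝ (fun p => (P.χ ℓ (P.node p) : ℂ))
          (LinearMap.mulLeft ℝ (fun p => (P.χ ℓ (P.node p) : ℂ)) V + P.localDefect Ω ΓD ℓ V) := by
  rw [Binv, Finset.sum_mul, Matrix.sum_mulVec]
  refine Finset.sum_congr rfl fun ℓ _ => ?_
  have hsplit : ((P.Aloc ΓD ℓ)⁻¹ * P.R ℓ * P.A Ω ΓD).mulVec V
      = (P.R ℓ).mulVec V + ((P.Aloc ΓD ℓ)⁻¹ * P.R ℓ * P.A Ω ΓD - P.R ℓ).mulVec V := by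
    rw [← Matrix.add_mulVec, add_sub_cancel]
  have hextend := Function.extend_add Subtype.val ((P.R ℓ).mulVec V)
    (((P.Aloc ΓD ℓ)⁻¹ * P.R ℓ * P.A Ω ΓD - P.R ℓ).mulVec V) (0 : Fin P.n → ℂ) 0
  rw [LinearMap.mulLeft_apply, LinearMap.mulLeft_apply, ← hP.extend_R_mulVec ℓ V, localDefect,
    ← hextend, ← hsplit, add_zero, ← R_transpose_mulVec, Matrix.mulVec_mulVec, Matrix.mul_assoc,
    Matrix.mul_assoc, Matrix.mul_assoc]

lemma nrm_energy (hP : P.Admissible Ω ΓD r c) {U : Set (E d)} (hU : P.IsMeshed U)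
    (V : Fin P.n → ℂ) : nrm (P.energy U) V = ‖complexify (hP.energyMap hU) V‖ := by
  rw [hP.energy_eq_gram hU, nrm_gram]

lemma complexify_energyMap_congr (hP : P.Admissible Ω ΓD r c) (hd : 0 < d) {U : Set (E d)}
    (hU : P.IsMeshed U) {V W : Fin P.n → ℂ} (h : ∀ p, P.node p ∈ closure U → V p = W p) :
    complexify (hP.energyMap hU) V = complexify (hP.energyMap hU) W :=
  congrArg (WithLp.toLp 2) (Prod.ext
    (hP.energyMap_congr hd hU fun p hp => congrArg Complex.re (h p hp))
    (hP.energyMap_congr hd hU fun p hp => congrArg Complex.im (h p hp)))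

lemma norm_energyMap_localDefect_le (hP : P.Admissible Ω ΓD r c) (hd : 0 < d) {ℓ : Fin P.N}
    (hσ : P.LocalBound Ω ΓD ℓ σ) (V : Fin P.n → ℂ) :
    ‖complexify (hP.energyMap (hP.isMeshed_sub ℓ)) (P.localDefect Ω ΓD ℓ V)‖
      ≤ σ * ‖complexify (hP.energyMap (hP.isMeshed_sub ℓ)) V‖ := by
  have hnrm : ∀ X, nrm (P.Dloc ℓ) X
      = ‖complexify (hP.energyMap (hP.isMeshed_sub ℓ)) (Function.extend Subtype.val X 0)‖ :=
    fun X => (nrm_submatrix Subtype.val_injective _ X).trans (hP.nrm_energy _ _)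
  have hrestrict := hP.complexify_energyMap_congr hd (hP.isMeshed_sub ℓ) (W := V) fun p hp =>
    Subtype.val_injective.extend_apply (fun q : P.LocalNode ℓ => V q.1) 0 ⟨p, hp⟩
  have hbound := hσ V
  rwa [hnrm, hnrm, hrestrict] at hbound

lemma nrm_Binv_mul_A_mulVec_le (hP : P.Admissible Ω ΓD r c) (hd : 0 < d)
    {hΩ : P.IsMeshed Ω}
    (h : IsSplitting (hP.energyMap hΩ) (fun ℓ => hP.energyMap (hP.isMeshed_sub ℓ))
      (fun ℓ => LinearMap.mulLeft ℝ (P.χ ℓ ∘ P.node)) hP.weightedEnergyMap P.Λ θ)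
    (hσ : 0 ≤ σ) (hlocal : ∀ ℓ, P.LocalBound Ω ΓD ℓ σ) (V : Fin P.n → ℂ) :
    nrm (P.D Ω) ((P.Binv ΓD * P.A Ω ΓD).mulVec V)
      ≤ P.Λ * ((1 + θ) * (1 + θ + σ)) * nrm (P.D Ω) V := by
  rw [D, hP.nrm_energy hΩ, hP.nrm_energy hΩ, hP.Binv_mul_A_mulVec]
  exact h.complexify.norm_schwarz_le hσ (fun ℓ => hP.norm_energyMap_localDefect_le hd (hlocal ℓ)) V

lemma le_norm_ip_Binv_mul_A_mulVec_div (hP : P.Admissible Ω ΓD r c) (hd : 0 < d)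
    {hΩ : P.IsMeshed Ω}
    (h : IsSplitting (hP.energyMap hΩ) (fun ℓ => hP.energyMap (hP.isMeshed_sub ℓ))
      (fun ℓ => LinearMap.mulLeft ℝ (P.χ ℓ ∘ P.node)) hP.weightedEnergyMap P.Λ θ)
    (hσ : 0 ≤ σ) (hlocal : ∀ ℓ, P.LocalBound Ω ΓD ℓ σ) {V : Fin P.n → ℂ} (hV : V ≠ 0) :
    1 / P.Λ - P.Λ * (θ * (2 + θ) + (1 + θ) * σ)
      ≤ ‖ip (P.D Ω) V ((P.Binv ΓD * P.A Ω ΓD).mulVec V)‖ / nrm (P.D Ω) V ^ 2 := by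
  have hlower := h.complexify.le_inner_schwarz hσ
    (fun ℓ => hP.norm_energyMap_localDefect_le hd (hlocal ℓ)) V
  have hpos : 0 < ‖complexify (hP.energyMap hΩ) V‖ := norm_pos_iff.2 <|
    (map_ne_zero_iff _ (complexify_injective (hP.energyMap_injective hd hΩ))).2 hV
  rw [D, hP.nrm_energy hΩ, le_div_iff₀ (pow_pos hpos 2), hP.Binv_mul_A_mulVec]
  refine hlower.trans (Eq.trans_le ?_ ((le_abs_self _).trans (Complex.abs_re_le_norm _)))
  rw [hP.energy_eq_gram hΩ, re_ip_gram, real_inner_comm]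
  rfl

end Admissible

end Discretisation

end Schwarz

end

theorem theorem3p9_general {d : ℕ} (hd : 0 < d) {r : ℕ} (hr : 1 ≤ r) (c : Schwarz.Constants) :
    ∃ C : ℝ, 0 < C ∧
      ∀ (Ω ΓD : Set (Schwarz.E d)) (P : Schwarz.Discretisation d) (σ : ℝ), Ω.Nonempty →
        interior (closure Ω) = Ω → P.Admissible Ω ΓD r c → 0 ≤ σ →
        (∀ ℓ, P.LocalBound Ω ΓD ℓ σ) →
        (∀ V : Fin P.n → ℂ,
          Schwarz.nrm (P.D Ω) ((P.Binv ΓD * P.A Ω ΓD).mulVec V)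
            ≤ C * (P.Λ * (1 + σ)) * Schwarz.nrm (P.D Ω) V) ∧
        ∃ R : ℝ, |R| ≤ C * (P.Λ / (P.k * P.δ)) * (1 + σ) ∧
          ∀ V : Fin P.n → ℂ, V ≠ 0 →
            (1 / P.Λ - σ * P.Λ) + R
              ≤ ‖Schwarz.ip (P.D Ω) V ((P.Binv ΓD * P.A Ω ΓD).mulVec V)‖
                / Schwarz.nrm (P.D Ω) V ^ 2 := by
  obtain ⟨K, hK, hsplitting⟩ := Schwarz.Discretisation.exists_isSplitting hd hr c
  have hcδ := c.cδ_pos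
  set t := K / c.cδ
  refine ⟨(1 + t) ^ 2 + K * (2 + t), by positivity, fun Ω ΓD P σ hne hreg hP hσ hlocal => ?_⟩
  have h := hsplitting Ω ΓD P hP (hP.isMeshed_domain hreg) hne
  have hkδ := hP.k_mul_δ_pos
  set θ := K / (P.k * P.δ) with hθ
  have hθt : θ ≤ t := div_le_div_of_nonneg_left hK hcδ hP.kδ_ge
  have hθnonneg := h.nonneg
  refine ⟨fun V => (hP.nrm_Binv_mul_A_mulVec_le hd h hσ hlocal V).trans ?_,
    -(P.Λ * (θ * (2 + θ + σ))), ?_, fun V hV =>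
      (le_of_eq ?_).trans (hP.le_norm_ip_Binv_mul_A_mulVec_div hd h hσ hlocal hV)⟩
  · calc P.Λ * ((1 + θ) * (1 + θ + σ)) * Schwarz.nrm (P.D Ω) V
        ≤ P.Λ * ((1 + t) * ((1 + t) * (1 + σ))) * Schwarz.nrm (P.D Ω) V := by
          gcongr
          exacts [Real.sqrt_nonneg _, by nlinarith]
      _ = (1 + t) ^ 2 * (P.Λ * (1 + σ)) * Schwarz.nrm (P.D Ω) V := by ring
      _ ≤ _ := by
          gcongr
          exacts [Real.sqrt_nonneg _, le_add_of_nonneg_right (by positivity)]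
  · rw [abs_neg, abs_of_nonneg (by positivity)]
    calc P.Λ * (θ * (2 + θ + σ)) ≤ P.Λ * (θ * ((2 + t) * (1 + σ))) := by
          gcongr
          nlinarith
      _ = K * (2 + t) * (P.Λ / (P.k * P.δ)) * (1 + σ) := by
          rw [hθ]
          ring
      _ ≤ _ := by
          gcongr
          exact le_add_of_nonneg_left (by positivity)
  · ring

theorem theorem3p9 {d : ℕ} (hd : d = 2 ∨ d = 3) (Ω ΓD : Set (Schwarz.E d))
    (hΩ : IsOpen Ω) (hΩne : Ω.Nonempty) (hΩreg : interior (closure Ω) = Ω)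
    (hΓD : ΓD ⊆ frontier Ω) (hΓI : 0 < Schwarz.surface d (frontier Ω \ ΓD))
    (r : ℕ) (hr : 2 ≤ r) (c : Schwarz.Constants) :
    ∃ C : ℝ, 0 < C ∧
      ∀ (ι : Type) (P : ι → Schwarz.Discretisation d) (σ : ι → ℝ),
        (∀ i, (P i).Admissible Ω ΓD r c) →
        (∀ i, 0 < σ i) →
        (∀ i ℓ, (P i).LocalBound Ω ΓD ℓ (σ i)) →
        (∀ i, ∀ V : Fin (P i).n → ℂ,
          Schwarz.nrm ((P i).D Ω) (((P i).Binv ΓD * (P i).A Ω ΓD).mulVec V)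
            ≤ C * ((P i).Λ * (1 + σ i)) * Schwarz.nrm ((P i).D Ω) V) ∧
        (Tendsto (fun i => (P i).k * (P i).δ) (comap (fun i => (P i).k) atTop) atTop →
          ∀ᶠ i in comap (fun i => (P i).k) atTop,
            ∃ R : ℝ, |R| ≤ C * ((P i).Λ / ((P i).k * (P i).δ)) * (1 + σ i) ∧
              ∀ V : Fin (P i).n → ℂ, V ≠ 0 →
                (1 / (P i).Λ - √2 * σ i * (P i).Λ) + R
                  ≤ ‖Schwarz.ip ((P i).D Ω) V (((P i).Binv ΓD * (P i).A Ω ΓD).mulVec V)‖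
                    / Schwarz.nrm ((P i).D Ω) V ^ 2) := by
  obtain ⟨C, hC, hbounds⟩ := theorem3p9_general (d := d) (by omega) (by omega : 1 ≤ r) c
  refine ⟨C, hC, fun ι P σ hP hσ hlocal => ?_⟩
  have hbound := fun i => hbounds Ω ΓD (P i) (σ i) hΩne hΩreg (hP i) (hσ i).le (hlocal i)
  refine ⟨fun i => (hbound i).1, fun _ => .of_forall fun i => (hbound i).2.imp fun R hR =>
    ⟨hR.1, fun V hV => le_trans ?_ (hR.2 V hV)⟩⟩
  gcongr
  exact le_mul_of_one_le_left (hσ i).le (Real.one_le_sqrt.2 one_le_two)
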